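/- Let $n\ge 1$, $0<s<1$, $p>2$, $p'=p/(p-1)$, $m\ge 2$, and let $\Omega\subset\mathbb{R}^n$ be a bounded open set (for instance a bounded domain). Write $J_p(\tau)=|\tau|^{p-2}\tau$ and $d\mu=|x-y|^{-n-sp}\,dx\,dy$. Notation. For $A\subset\mathbb{R}^n$ open, $W^{s,p}(A)$ is normed by $\|g\|_{W^{s,p}(A)}^p=\int_A|g|^p\,dx+\iint_{A\times A}|g(x)-g(y)|^p\,d\mu$; $W^{s,p}_0(\Omega)$ is the closure of $C_0^\infty(\Omega)$ in $W^{s,p}(\mathbb{R}^n)$; $L^{p-1}_{sp}(\mathbb{R}^n)$ is the space of $g$ with $\int_{\mathbb{R}^n}|g|^{p-1}(1+|x|^{n+sp})^{-1}dx<\infty$. For a bounded open set $\Omega'$ with $\overline\Omega\subset\Omega'$ let $X^{s,p}_0(\Omega,\Omega')=\{g\in W^{s,p}(\Omega')\cap L^{p-1}_{sp}(\mathbb{R}^n): g=0 \text{ a.e. on } \mathbb{R}^n\setminus\Omega\}$, normed by $W^{s,p}(\Omega')$. For a space $V$, $L^q_{\rm loc}((0,\infty);V)$ denotes the functions that belong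 to $L^q([T_0,T_1];V)$ whenever $0<T_0<T_1$. For $f\in L^{p'}_{\rm loc}((0,\infty);(X^{s,p}_0(\Omega,\Omega'))^*)$, a function $u$ is a weak solution of $u_t+(-\Delta_p)^su=f$ in $\Omega\times(0,\infty)$ if for every $0<T_0<T_1$, with $J=[T_0,T_1]$, $$u\in L^p(J;W^{s,p}(\Omega'))\cap L^{p-1}(J;L^{p-1}_{sp}(\mathbb{R}^n))\cap C(J;L^2(\Omega))$$ and $$-\int_J\int_\Omega u\,\partial_t\phi\,dx\,dt+\int_J\iint_{\mathbb{R}^n\times\mathbb{R}^n}J_p(u(x,t)-u(y,t))(\phi(x,t)-\phi(y,t))\,d\mu\,dt=\int_\Omega u(x,T_0)\phi(x,T_0)\,dx-\int_\Omega u(x,T_1)\phi(x,T_1)\,dx+\int_J\langle f(\cdot,t),\phi(\cdot,t)\rangle\,dt$$ for every $\phi\in L^p(J;X^{s,p}_0(\Omega,\Omega'))\cap C^1(J;L^2(\Omega))$. Proposition. There is a constant $C=C(\Omega,m,n,p,s)>0$ with the following property. Let $\Omega'$ and $f$ be as above, let $u$ and $v$ be weak solutions of $u_t+(-\Delta_p)^su=f$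 in $\Omega\times(0,\infty)$ (with the same $f$), and assume that $w=u-v\in L^p_{\rm loc}((0,\infty);W^{s,p}_0(\Omega))$. Put $I_m(t)=\int_\Omega|w(x,t)|^m\,dx\in[0,\infty]$ for $t>0$. Then $I_m$ is non-increasing on $(0,\infty)$, and for all $t_2\ge t_1>0$ $$I_m(t_2)\le\min\left(C(t_2-t_1)^{-\frac{m}{p-2}},\,I_m(t_1)\right),$$ where $C(t_2-t_1)^{-m/(p-2)}$ is read as $+\infty$ if $t_1=t_2$. -/

import Mathlib

open MeasureTheory Set Filter
open scoped ENNReal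

noncomputable section

namespace FracParabolic

/-- `ℝⁿ` with its Euclidean norm. -/
abbrev Eu (n : ℕ) : Type := EuclideanSpace ℝ (Fin n)

variable {n : ℕ}

/-- `J_p(t) = |t|^{p-2} t`. -/
def J (p t : ℝ) : ℝ := |t| ^ (p - 2) * t

/-- The measure `dμ = |x - y|^{-n-sp} dx dy` on `ℝⁿ × ℝⁿ`. -/
def fracMeasure (n : ℕ) (s p : ℝ) : Measure (Eu n × Eu n) :=
  (volume.prod volume).withDensity
    fun z => ENNReal.ofReal (‖z.1 - z.2‖ ^ (-((n : ℝ) + s * p)))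

/-- The measure `(1 + |x|^{n+α})⁻¹ dx` on `ℝⁿ`. -/
def tailMeasure (n : ℕ) (α : ℝ) : Measure (Eu n) :=
  volume.withDensity fun x => ENNReal.ofReal ((1 + ‖x‖ ^ ((n : ℝ) + α))⁻¹)

/-! ### Function spaces in the space variable -/

/-- The fractional Sobolev norm of `g` on `A`:
`(∫_A |g|^p dx + ∬_{A × A} |g(x) - g(y)|^p dμ)^{1/p}`. -/
def sobolevENorm (s p : ℝ) (A : Set (Eu n)) (g : Eu n → ℝ) : ℝ≥0∞ :=
  (eLpNorm g (ENNReal.ofReal p) (volume.restrict A) ^ p +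
    eLpNorm (fun z : Eu n × Eu n => g z.1 - g z.2) (ENNReal.ofReal p)
      ((fracMeasure n s p).restrict (A ×ˢ A)) ^ p) ^ (1 / p)

/-- `W^{s,p}(A)`. -/
def sobolevSpace (s p : ℝ) (A : Set (Eu n)) : Submodule ℝ (Eu n → ℝ) where
  carrier := {g | MemLp g (ENNReal.ofReal p) (volume.restrict A) ∧
    MemLp (fun z : Eu n × Eu n => g z.1 - g z.2) (ENNReal.ofReal p)
      ((fracMeasure n s p).restrict (A ×ˢ A))}
  zero_mem' := by
    refine ⟨MemLp.zero', ?_⟩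
    simp
  add_mem' := by
    rintro a b ⟨ha, ha'⟩ ⟨hb, hb'⟩
    refine ⟨ha.add hb, ?_⟩
    convert ha'.add hb' using 1
    funext z
    simp only [Pi.add_apply]
    ring
  smul_mem' := by
    rintro c a ⟨ha, ha'⟩
    refine ⟨ha.const_smul c, ?_⟩
    convert ha'.const_smul c using 1
    funext z
    simp only [Pi.smul_apply, smul_eq_mul]
    ring

/-- `W_0^{s,p}(Ω)`: the closure of `C_0^∞(Ω)` in `W^{s,p}(ℝⁿ)`. -/
def sobolevZero (s p : ℝ) (Ω : Set (Eu n)) : Set (Eu n → ℝ) :=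
  {g | g ∈ sobolevSpace s p (univ : Set (Eu n)) ∧
    ∀ ε : ℝ≥0∞, 0 < ε → ∃ φ : Eu n → ℝ,
      ContDiff ℝ ((⊤ : ℕ∞) : WithTop ℕ∞) φ ∧ HasCompactSupport φ ∧ tsupport φ ⊆ Ω ∧
      sobolevENorm s p univ (g - φ) < ε}

/-- The norm of the tail space `L^q_α(ℝⁿ)`. -/
def tailENorm (q α : ℝ) (g : Eu n → ℝ) : ℝ≥0∞ :=
  eLpNorm g (ENNReal.ofReal q) (tailMeasure n α)

/-- The tail space `L^q_α(ℝⁿ)`. Membership in `L^q_loc` is automatic, since the weight is bounded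
below on bounded sets. -/
def tailSpace (n : ℕ) (q α : ℝ) : Submodule ℝ (Eu n → ℝ) where
  carrier := {g | MemLp g (ENNReal.ofReal q) (tailMeasure n α)}
  zero_mem' := MemLp.zero'
  add_mem' := fun ha hb => MemLp.add ha hb
  smul_mem' := fun c _ ha => MemLp.const_smul ha c

/-- Functions that vanish almost everywhere outside `Ω`. -/
def vanishOutside (Ω : Set (Eu n)) : Submodule ℝ (Eu n → ℝ) where
  carrier := {g | ∀ᵐ x ∂(volume : Measure (Eu n)), x ∉ Ω → g x = 0}
  zero_mem' := by
    rw [mem_ofPred_eq]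
    exact Eventually.of_forall fun _ _ => rfl
  add_mem' := by
    intro a b ha hb
    rw [mem_ofPred_eq] at ha hb ⊢
    filter_upwards [ha, hb] with x hx hx' hΩ
    simp [hx hΩ, hx' hΩ]
  smul_mem' := by
    intro c a ha
    rw [mem_ofPred_eq] at ha ⊢
    filter_upwards [ha] with x hx hΩ
    simp [hx hΩ]

/-- `X_0^{s,p}(Ω, Ω') = {g ∈ W^{s,p}(Ω') ∩ L^{p-1}_{sp}(ℝⁿ) : g = 0 on ℝⁿ ∖ Ω}`, normed by
`W^{s,p}(Ω')`. -/
def X0 (s p : ℝ) (Ω Ω' : Set (Eu n)) : Submodule ℝ (Eu n → ℝ) :=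
  sobolevSpace s p Ω' ⊓ tailSpace n (p - 1) (s * p) ⊓ vanishOutside Ω

/-- The dual norm of a linear functional on `X_0^{s,p}(Ω, Ω')`; the functional belongs to the dual
space exactly if this is finite (`0 / 0 = 0` and `a / 0 = ∞` for `a > 0`). -/
def dualENorm {s p : ℝ} {Ω Ω' : Set (Eu n)} (F : X0 s p Ω Ω' →ₗ[ℝ] ℝ) : ℝ≥0∞ :=
  ⨆ g : X0 s p Ω Ω', ‖F g‖ₑ / sobolevENorm s p Ω' (g : Eu n → ℝ)

open Classical in
/-- The pairing `⟨F, g⟩` of a functional on `X_0^{s,p}(Ω, Ω')` with an element `g` of that space. -/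
def dualPair {s p : ℝ} {Ω Ω' : Set (Eu n)} (F : X0 s p Ω Ω' →ₗ[ℝ] ℝ) (g : Eu n → ℝ) : ℝ :=
  if h : g ∈ X0 s p Ω Ω' then F ⟨g, h⟩ else 0

/-! ### Function spaces in space and time -/

/-- `u ∈ L^q(I; V)`, where `V` is a space of functions on `ℝⁿ` with norm `N`. -/
def MemBochner (q : ℝ) (I : Set ℝ) (V : Set (Eu n → ℝ)) (N : (Eu n → ℝ) → ℝ≥0∞)
    (u : ℝ → Eu n → ℝ) : Prop :=
  AEStronglyMeasurable (fun z : ℝ × Eu n => u z.1 z.2) ((volume.restrict I).prod volume) ∧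
  (∀ᵐ t ∂volume.restrict I, u t ∈ V) ∧
  AEMeasurable (fun t => N (u t)) (volume.restrict I) ∧
  ∫⁻ t in I, N (u t) ^ q < ∞

/-- `f ∈ L^q(I; (X_0^{s,p}(Ω, Ω'))^*)`. The dual space is separable and reflexive, so that
measurability of `f` is measurability of `t ↦ ⟨f(t), g⟩` for every `g`. -/
def MemBochnerDual {s p : ℝ} {Ω Ω' : Set (Eu n)} (q : ℝ) (I : Set ℝ)
    (f : ℝ → (X0 s p Ω Ω' →ₗ[ℝ] ℝ)) : Prop :=
  (∀ g : X0 s p Ω Ω', AEMeasurable (fun t => f t g) (volume.restrict I)) ∧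
  (∀ᵐ t ∂volume.restrict I, dualENorm (f t) < ∞) ∧
  AEMeasurable (fun t => dualENorm (f t)) (volume.restrict I) ∧
  ∫⁻ t in I, dualENorm (f t) ^ q < ∞

/-- The curve `U` in `L²(Ω)` is `t ↦ u(·,t)` for `t ∈ I`. -/
def IsL2Curve (I : Set ℝ) (Ω : Set (Eu n)) (u : ℝ → Eu n → ℝ)
    (U : ℝ → Lp ℝ 2 (volume.restrict Ω)) : Prop :=
  ∀ t ∈ I, U t =ᵐ[volume.restrict Ω] u t

/-- `u` is a weak solution of `∂_t u + (-Δ_p)^s u = f` in `Ω × I`. The function `φ` runs through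
`L^p([T₀,T₁]; X_0^{s,p}(Ω, Ω')) ∩ C¹([T₀,T₁]; L²(Ω))`, and `Φ` is `φ` as a curve in `L²(Ω)`. -/
def IsWeakSolution (s p : ℝ) (Ω Ω' : Set (Eu n)) (I : Set ℝ)
    (f : ℝ → (X0 s p Ω Ω' →ₗ[ℝ] ℝ)) (u : ℝ → Eu n → ℝ) : Prop :=
  ∀ T₀ T₁ : ℝ, T₀ < T₁ → Icc T₀ T₁ ⊆ I →
    MemBochner p (Icc T₀ T₁) (sobolevSpace s p Ω') (sobolevENorm s p Ω') u ∧
    MemBochner (p - 1) (Icc T₀ T₁) (tailSpace n (p - 1) (s * p))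
      (tailENorm (p - 1) (s * p)) u ∧
    (∃ U : ℝ → Lp ℝ 2 (volume.restrict Ω),
      ContinuousOn U (Icc T₀ T₁) ∧ IsL2Curve (Icc T₀ T₁) Ω u U) ∧
    ∀ (φ : ℝ → Eu n → ℝ) (Φ : ℝ → Lp ℝ 2 (volume.restrict Ω)),
      MemBochner p (Icc T₀ T₁) (X0 s p Ω Ω') (sobolevENorm s p Ω') φ →
      ContDiffOn ℝ 1 Φ (Icc T₀ T₁) →
      IsL2Curve (Icc T₀ T₁) Ω φ Φ →
      -(∫ t in Icc T₀ T₁, ∫ x in Ω, u t x * (derivWithin Φ (Icc T₀ T₁) t) x)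
        + ∫ t in Icc T₀ T₁, ∫ z : Eu n × Eu n,
            J p (u t z.1 - u t z.2) * (φ t z.1 - φ t z.2) ∂fracMeasure n s p
      = (∫ x in Ω, u T₀ x * φ T₀ x) - (∫ x in Ω, u T₁ x * φ T₁ x)
        + ∫ t in Icc T₀ T₁, dualPair (f t) (φ t)

/-- `I_m(t) = ∫_Ω |w(x,t)|^m dx`, with values in `[0,∞]`. -/
def powerIntegral (Ω : Set (Eu n)) (m : ℝ) (w : ℝ → Eu n → ℝ) (t : ℝ) : ℝ≥0∞ :=
  ∫⁻ x in Ω, ‖w t x‖ₑ ^ m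

end FracParabolic

end

open FracParabolic

/-!
The function `w = u - v` satisfies `∂_t w + (-Δ_p)^s u - (-Δ_p)^s v = 0` and vanishes outside `Ω`.
Formally one tests this equation with `m |w|^{m-2} w`: the time derivative gives the derivative of
`I_m`, and the diffusion term is bounded below by a multiple of `∫_Ω |w|^{m+p-2}`, because `J p` is
uniformly monotone (`rpow_mul_le_J_sub_J_mul`) and each point of `Ω` interacts with a ball outside
`Ω`, where `w` is zero (`exists_far_ball`, `exists_coercive`). By Jensen's inequality
`I_m' ≤ -κ I_m^{1+(p-2)/m}`, and all solutions of this differential inequality decay at the asserted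
rate, whatever their initial value (`le_rpow_of_integral_inequality`).

To make this rigorous, the power is replaced by the convex function `truncPrim m k`, which equals
`|τ|^m` for `|τ| ≤ k` and is affine elsewhere, so that its derivative `truncPow m k` is bounded and
Lipschitz. The superlinear inequality survives the truncation with a constant independent of `k`
(`truncPrim_rpow_le`), and Fatou's lemma removes the truncation at the end
(`powerIntegral_le_of_truncated`).

Since `w` has no time derivative in `L²`, the test function is the forward Steklov average in time
of `g(w)`, with `g = truncPow m k`. It is `C¹` with values in `L²` although `g` is only Lipschitz.
The time term is handled by a discrete chain rule that rests on convexity alone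
(`integral_inner_deriv_steklov_le`); the forward direction of the average gives the right sign. In
the diffusion term the averages are removed by Lebesgue's differentiation theorem on time slices,
with a majorant obtained from Young's inequality on `Ω' × Ω'` and from the tail space between `Ω`
and the complement of `Ω'` (`tendsto_integral_mul_steklov`, `tendsto_diffusion_steklov`). The result
is `energy_inequality`.
-/

open scoped Topology NNReal

namespace FracParabolic

/-! ### The monotone nonlinearity `J` -/

lemma J_of_nonneg {p t : ℝ} (hp : 2 < p) (ht : 0 ≤ t) : J p t = t ^ (p - 1) := by
  rw [J, abs_of_nonneg ht]
  rcases ht.eq_or_lt with rfl | h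
  · rw [mul_zero, Real.zero_rpow (by linarith)]
  · rw [← Real.rpow_add_one h.ne']; congr 1; ring

lemma J_neg (p t : ℝ) : J p (-t) = -J p t := by
  simp [J]

lemma abs_J {p : ℝ} (hp : 2 < p) (t : ℝ) : |J p t| = |t| ^ (p - 1) := by
  rw [← J_of_nonneg hp (abs_nonneg t)]
  have := Real.rpow_nonneg (abs_nonneg t) (p - 2)
  simp only [J, abs_mul, abs_abs, abs_of_nonneg this]

lemma continuous_J {p : ℝ} (hp : 2 < p) : Continuous (J p) := by
  unfold J
  exact ((continuous_abs).rpow_const fun _ => Or.inr (by linarith)).mul continuous_id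

/-- Uniform monotonicity of `J p` for `p > 2`. -/
lemma rpow_sub_le_J_sub_J {p A B : ℝ} (hp : 2 < p) (h : B ≤ A) :
    2 ^ (1 - p) * (A - B) ^ (p - 1) ≤ J p A - J p B := by
  have key : ∀ A B : ℝ, 0 ≤ A → B ≤ A → 2 ^ (1 - p) * (A - B) ^ (p - 1) ≤ J p A - J p B := by
    intro A B hA h
    rcases le_total 0 B with hB | hB
    · rw [J_of_nonneg hp hA, J_of_nonneg hp hB]
      have h1 : (A - B) ^ (p - 1) + B ^ (p - 1) ≤ A ^ (p - 1) := by
        lift B to ℝ≥0 using hB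
        obtain ⟨D, hD⟩ : ∃ D : ℝ≥0, (D : ℝ) = A - B := ⟨⟨A - B, by linarith⟩, rfl⟩
        have := NNReal.add_rpow_le_rpow_add (p := p - 1) D B (by linarith)
        have := NNReal.coe_le_coe.2 this
        push_cast at this
        rwa [hD, sub_add_cancel] at this
      have h2 : (2 : ℝ) ^ (1 - p) ≤ 1 := Real.rpow_le_one_of_one_le_of_nonpos one_le_two (by linarith)
      have h3 : 0 ≤ (A - B) ^ (p - 1) := Real.rpow_nonneg (by linarith) _
      nlinarith
    · obtain ⟨C, rfl⟩ : ∃ C, B = -C := ⟨-B, by simp⟩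
      have hC : 0 ≤ C := by linarith
      rw [J_neg, J_of_nonneg hp hA, J_of_nonneg hp hC, sub_neg_eq_add, sub_neg_eq_add]
      have e : (2 : ℝ) ^ (1 - p) * (A + C) ^ (p - 1) = ((A + C) / 2) ^ (p - 1) := by
        rw [Real.div_rpow (by linarith) two_pos.le, div_eq_inv_mul, ← Real.rpow_neg two_pos.le]
        congr 2; ring
      rw [e]
      have hA' := Real.rpow_nonneg hA (p - 1)
      have hC' := Real.rpow_nonneg hC (p - 1)
      rcases le_total A C with h | h
      · have := Real.rpow_le_rpow (z := p - 1) (by linarith) (show (A + C) / 2 ≤ C by linarith)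
          (by linarith)
        linarith
      · have := Real.rpow_le_rpow (z := p - 1) (by linarith) (show (A + C) / 2 ≤ A by linarith)
          (by linarith)
        linarith
  rcases le_total 0 A with hA | hA
  · exact key A B hA h
  · have := key (-B) (-A) (by linarith) (by linarith)
    rw [J_neg, J_neg] at this
    have e : -B - -A = A - B := by ring
    rw [e] at this
    linarith

lemma monotone_J {p : ℝ} (hp : 2 < p) : Monotone (J p) := by
  intro B A h
  have h1 := rpow_sub_le_J_sub_J hp h
  have : 0 ≤ 2 ^ (1 - p) * (A - B) ^ (p - 1) := by
    have : 0 ≤ A - B := by linarith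
    positivity
  linarith

/-- The difference of two values of `J p`, tested with a difference of values of a monotone
function, is non-negative. -/
lemma J_sub_J_mul_nonneg {p : ℝ} (hp : 2 < p) {g : ℝ → ℝ} (hg : Monotone g)
    (a b c d : ℝ) : 0 ≤ (J p (a - b) - J p (c - d)) * (g (a - c) - g (b - d)) := by
  rcases le_total (a - c) (b - d) with h | h
  · have h1 := hg h
    have h2 := monotone_J hp (show a - b ≤ c - d by linarith)
    nlinarith
  · have h1 := hg h
    have h2 := monotone_J hp (show c - d ≤ a - b by linarith)
    nlinarith

lemma rpow_mul_le_J_sub_J_mul {p : ℝ} (hp : 2 < p) {g : ℝ → ℝ} (hg : Monotone g) (g0 : g 0 = 0)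
    {a b c d : ℝ} (h : b - d = 0) :
    2 ^ (1 - p) * (|a - c| ^ (p - 1) * |g (a - c)|) ≤
      (J p (a - b) - J p (c - d)) * (g (a - c) - g (b - d)) := by
  rw [h, g0, sub_zero]
  have e : (a - b) - (c - d) = a - c := by linarith
  rcases le_total 0 (a - c) with h1 | h1
  · have h2 := rpow_sub_le_J_sub_J hp (show c - d ≤ a - b by linarith)
    have h3 := hg h1
    rw [g0] at h3
    rw [abs_of_nonneg h1, abs_of_nonneg h3]
    rw [e] at h2
    nlinarith
  · have h2 := rpow_sub_le_J_sub_J hp (show a - b ≤ c - d by linarith)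
    have h3 := hg h1
    rw [g0] at h3
    rw [abs_of_nonpos h1, abs_of_nonpos h3]
    rw [show c - d - (a - b) = -(a - c) by linarith] at h2
    nlinarith

/-! ### Truncated powers -/

/-- The function `τ ↦ m · min(τ₊, k)^{m-1}`. -/
noncomputable def truncPowPos (m k τ : ℝ) : ℝ := m * (max 0 (min τ k)) ^ (m - 1)

/-- The derivative of `τ ↦ |τ|^m`, frozen outside `[-k, k]`. -/
noncomputable def truncPow (m k τ : ℝ) : ℝ := truncPowPos m k τ - truncPowPos m k (-τ)

/-- The primitive of `truncPow m k`: the convex function equal to `|τ|^m` on `[-k, k]` and affine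
on either side of that interval. -/
noncomputable def truncPrim (m k τ : ℝ) : ℝ := ∫ r in (0 : ℝ)..τ, truncPow m k r

section truncPow

variable {m k : ℝ}

lemma truncPowPos_nonneg (hm : 2 ≤ m) (τ : ℝ) : 0 ≤ truncPowPos m k τ := by
  unfold truncPowPos
  have : 0 ≤ max 0 (min τ k) := le_max_left _ _
  positivity

lemma truncPowPos_mono (hm : 2 ≤ m) : Monotone (truncPowPos m k) := by
  intro a b h
  unfold truncPowPos
  gcongr
  linarith

lemma truncPowPos_of_nonpos (hm : 2 ≤ m) {τ : ℝ} (h : τ ≤ 0) : truncPowPos m k τ = 0 := by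
  unfold truncPowPos
  rw [max_eq_left ((min_le_left _ _).trans h), Real.zero_rpow (by linarith), mul_zero]

lemma truncPowPos_le (hm : 2 ≤ m) (hk : 0 < k) (τ : ℝ) : truncPowPos m k τ ≤ m * k ^ (m - 1) := by
  unfold truncPowPos
  gcongr
  · linarith
  · exact max_le hk.le (min_le_right _ _)

lemma lipschitzOnWith_rpow {q : ℝ} (hq : 1 ≤ q) (hk : 0 < k) :
    LipschitzOnWith (q * k ^ (q - 1)).toNNReal (fun x : ℝ => x ^ q) (Icc 0 k) := by
  refine (convex_Icc 0 k).lipschitzOnWith_of_nnnorm_hasDerivWithin_le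
    (f' := fun x => q * x ^ (q - 1)) ?_ ?_
  · intro x _
    exact (Real.hasDerivAt_rpow_const (Or.inr hq)).hasDerivWithinAt
  · intro x hx
    rw [← NNReal.coe_le_coe, coe_nnnorm, Real.coe_toNNReal _ (by positivity), Real.norm_eq_abs,
      abs_of_nonneg (by have := hx.1; positivity)]
    have := hx.1
    have := hx.2
    gcongr

lemma lipschitzWith_truncPowPos (hm : 2 ≤ m) (hk : 0 < k) :
    ∃ L, LipschitzWith L (truncPowPos m k) := by
  refine ⟨Real.toNNReal m * (((m - 1) * k ^ (m - 1 - 1)).toNNReal * 1), ?_⟩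
  have h1 : LipschitzWith 1 fun τ : ℝ => max 0 (min τ k) :=
    (LipschitzWith.id.min_const k).const_max 0
  have h2 : LipschitzOnWith (((m - 1) * k ^ (m - 1 - 1)).toNNReal * 1)
      ((fun x : ℝ => x ^ (m - 1)) ∘ fun τ : ℝ => max 0 (min τ k)) univ :=
    (lipschitzOnWith_rpow (q := m - 1) (by linarith) hk).comp h1.lipschitzOnWith
      fun τ _ => ⟨le_max_left _ _, max_le hk.le (min_le_right _ _)⟩
  rw [lipschitzOnWith_univ] at h2
  refine LipschitzWith.of_dist_le_mul fun x y => ?_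
  have h3 := h2.dist_le_mul x y
  rw [NNReal.coe_mul, Real.coe_toNNReal _ (by linarith), mul_assoc]
  simp only [truncPowPos, Real.dist_eq, Function.comp] at h3 ⊢
  rw [← mul_sub, abs_mul, abs_of_nonneg (by linarith : 0 ≤ m)]
  gcongr

lemma truncPow_mono (hm : 2 ≤ m) : Monotone (truncPow m k) := fun a b h => by
  have h1 := truncPowPos_mono (k := k) hm h
  have h2 := truncPowPos_mono (k := k) hm (neg_le_neg h)
  unfold truncPow
  linarith

lemma truncPow_zero : truncPow m k 0 = 0 := by simp [truncPow]

lemma truncPow_neg (τ : ℝ) : truncPow m k (-τ) = -truncPow m k τ := by simp [truncPow]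

lemma lipschitzWith_truncPow (hm : 2 ≤ m) (hk : 0 < k) :
    ∃ L, LipschitzWith L (truncPow m k) := by
  obtain ⟨L, hL⟩ := lipschitzWith_truncPowPos hm hk
  exact ⟨_, hL.sub (hL.comp LipschitzWith.id.neg)⟩

lemma continuous_truncPow (hm : 2 ≤ m) (hk : 0 < k) : Continuous (truncPow m k) :=
  (lipschitzWith_truncPow hm hk).choose_spec.continuous

lemma abs_truncPow_le (hm : 2 ≤ m) (hk : 0 < k) (τ : ℝ) :
    |truncPow m k τ| ≤ m * k ^ (m - 1) := by
  have h1 := truncPowPos_le hm hk τ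
  have h2 := truncPowPos_le hm hk (-τ)
  have h3 := truncPowPos_nonneg (k := k) hm τ
  have h4 := truncPowPos_nonneg (k := k) hm (-τ)
  unfold truncPow
  rw [abs_le]
  constructor <;> linarith

lemma truncPow_of_nonneg (hm : 2 ≤ m) (hk : 0 < k) {τ : ℝ} (h : 0 ≤ τ) :
    truncPow m k τ = m * (min τ k) ^ (m - 1) := by
  rw [truncPow, truncPowPos_of_nonpos hm (neg_nonpos.2 h), sub_zero, truncPowPos,
    max_eq_right (le_min h hk.le)]

lemma truncPow_intervalIntegrable (hm : 2 ≤ m) (hk : 0 < k) (a b : ℝ) :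
    IntervalIntegrable (truncPow m k) volume a b :=
  (continuous_truncPow hm hk).intervalIntegrable _ _

lemma truncPrim_sub (hm : 2 ≤ m) (hk : 0 < k) (a b : ℝ) :
    truncPrim m k b - truncPrim m k a = ∫ r in a..b, truncPow m k r :=
  intervalIntegral.integral_interval_sub_left (truncPow_intervalIntegrable hm hk _ _)
    (truncPow_intervalIntegrable hm hk _ _)

/-- The subgradient inequality for the convex function `truncPrim m k`. -/
lemma truncPrim_sub_le (hm : 2 ≤ m) (hk : 0 < k) (a b : ℝ) :
    truncPrim m k b - truncPrim m k a ≤ truncPow m k b * (b - a) := by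
  rw [truncPrim_sub hm hk]
  rcases le_total a b with h | h
  · calc ∫ r in a..b, truncPow m k r ≤ ∫ _ in a..b, truncPow m k b :=
        intervalIntegral.integral_mono_on h (truncPow_intervalIntegrable hm hk _ _) (by simp)
          fun x hx => truncPow_mono hm hx.2
      _ = _ := by simp [mul_comm]
  · rw [intervalIntegral.integral_symm]
    have : ∫ _ in b..a, truncPow m k b ≤ ∫ r in b..a, truncPow m k r :=
      intervalIntegral.integral_mono_on h (by simp) (truncPow_intervalIntegrable hm hk _ _)
        fun x hx => truncPow_mono hm hx.1
    simp only [intervalIntegral.integral_const, smul_eq_mul] at this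
    linarith

lemma truncPrim_zero : truncPrim m k 0 = 0 := by simp [truncPrim]

lemma truncPrim_nonneg (hm : 2 ≤ m) (hk : 0 < k) (τ : ℝ) : 0 ≤ truncPrim m k τ := by
  have := truncPrim_sub_le hm hk τ 0
  rw [truncPow_zero, truncPrim_zero] at this
  linarith

lemma lipschitzWith_truncPrim (hm : 2 ≤ m) (hk : 0 < k) :
    LipschitzWith (m * k ^ (m - 1)).toNNReal (truncPrim m k) := by
  refine LipschitzWith.of_dist_le_mul fun a b => ?_
  rw [Real.coe_toNNReal _ (by positivity), Real.dist_eq, Real.dist_eq, truncPrim_sub hm hk]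
  exact intervalIntegral.norm_integral_le_of_norm_le_const fun x _ =>
    (Real.norm_eq_abs _).trans_le (abs_truncPow_le hm hk x)

lemma truncPrim_neg (τ : ℝ) : truncPrim m k (-τ) = truncPrim m k τ := by
  have := intervalIntegral.integral_comp_neg (a := 0) (b := τ) (truncPow m k)
  simp only [truncPow_neg, intervalIntegral.integral_neg, neg_zero] at this
  unfold truncPrim
  rw [intervalIntegral.integral_symm (-τ) 0]
  linarith

lemma truncPrim_abs (τ : ℝ) : truncPrim m k |τ| = truncPrim m k τ := by
  rcases abs_choice τ with h | h <;> rw [h]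
  exact truncPrim_neg τ

lemma integral_mul_rpow (hm : 2 ≤ m) (τ : ℝ) :
    ∫ r in (0 : ℝ)..τ, m * r ^ (m - 1) = τ ^ m := by
  rw [intervalIntegral.integral_const_mul, integral_rpow (Or.inl (by linarith)),
    sub_add_cancel, Real.zero_rpow (by linarith), sub_zero, mul_div_cancel₀ _ (by linarith)]

lemma truncPrim_le (hm : 2 ≤ m) (hk : 0 < k) (τ : ℝ) : truncPrim m k τ ≤ |τ| ^ m := by
  rw [← truncPrim_abs, truncPrim, ← integral_mul_rpow hm]
  refine intervalIntegral.integral_mono_on (abs_nonneg τ) (truncPow_intervalIntegrable hm hk _ _)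
    (((continuous_id.rpow_const fun _ => Or.inr (by linarith)).const_mul m).intervalIntegrable _ _)
    fun x hx => ?_
  rw [truncPow_of_nonneg hm hk hx.1]
  have := hx.1
  gcongr
  · linarith
  · exact min_le_left _ _

lemma truncPrim_eq (hm : 2 ≤ m) (hk : 0 < k) {τ : ℝ} (h : |τ| ≤ k) :
    truncPrim m k τ = |τ| ^ m := by
  rw [← truncPrim_abs, truncPrim, ← integral_mul_rpow hm]
  refine intervalIntegral.integral_congr fun x hx => ?_
  rw [uIcc_of_le (abs_nonneg τ)] at hx
  rw [truncPow_of_nonneg hm hk hx.1, min_eq_left (hx.2.trans h)]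

lemma mul_truncPow_eq (hm : 2 ≤ m) (τ : ℝ) : truncPow m k τ * τ = |τ| * |truncPow m k τ| := by
  rw [← abs_mul, mul_comm, abs_of_nonneg]
  rcases le_total 0 τ with h | h
  · have := truncPow_mono (k := k) hm h
    rw [truncPow_zero] at this
    positivity
  · have := truncPow_mono (k := k) hm h
    rw [truncPow_zero] at this
    exact mul_nonneg_of_nonpos_of_nonpos h this

/-- The pointwise inequality that makes the energy inequality superlinear, with a constant
independent of the truncation height `k`. -/
lemma truncPrim_rpow_le {p : ℝ} (hp : 2 < p) (hm : 2 ≤ m) (hk : 0 < k) (τ : ℝ) :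
    truncPrim m k τ ^ (1 + (p - 2) / m) ≤ |τ| ^ (p - 1) * |truncPow m k τ| := by
  have hG := truncPrim_nonneg hm hk τ
  rcases hG.eq_or_lt with h0 | h0
  · rw [← h0, Real.zero_rpow (by positivity)]
    positivity
  have hτ : 0 < |τ| := abs_pos.2 fun h => by simp [h, truncPrim_zero] at h0
  have h1 : truncPrim m k τ ≤ |τ| * |truncPow m k τ| := by
    have := truncPrim_sub_le hm hk 0 τ
    rw [truncPrim_zero, sub_zero, sub_zero, mul_truncPow_eq hm] at this
    exact this
  have h2 : truncPrim m k τ ^ ((p - 2) / m) ≤ |τ| ^ (p - 2) := by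
    calc truncPrim m k τ ^ ((p - 2) / m) ≤ (|τ| ^ m) ^ ((p - 2) / m) :=
          Real.rpow_le_rpow hG (truncPrim_le hm hk τ) (by apply div_nonneg <;> linarith)
      _ = _ := by rw [← Real.rpow_mul hτ.le, mul_div_cancel₀ _ (by linarith)]
  rw [Real.rpow_add h0, Real.rpow_one]
  calc truncPrim m k τ * truncPrim m k τ ^ ((p - 2) / m)
      ≤ |τ| * |truncPow m k τ| * |τ| ^ (p - 2) := by gcongr
    _ = |τ| ^ (p - 1) * |truncPow m k τ| := by
      rw [show p - 1 = (p - 2) + 1 by ring, Real.rpow_add_one hτ.ne']; ring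

end truncPow

/-! ### Decay from a superlinear integral inequality -/

/-- A continuous non-negative solution of `y(b) + κ ∫_t^b y^{1+σ} ≤ y(t)` decays at the rate of the
solution of `y' = -κ y^{1+σ}` that starts from `+∞`. -/
lemma le_rpow_of_integral_inequality {Y : ℝ → ℝ} {a b κ σ : ℝ} (hκ : 0 < κ)
    (hσ : 0 < σ) (hab : a < b) (hY : Continuous Y) (hY0 : ∀ t, 0 ≤ Y t)
    (h : ∀ t ∈ Icc a b, Y b + κ * ∫ r in t..b, Y r ^ (1 + σ) ≤ Y t) :
    Y b ≤ (κ * σ * (b - a)) ^ (-1 / σ) := by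
  rcases (hY0 b).eq_or_lt with hb | hb
  · rw [← hb]
    have : 0 < b - a := by linarith
    positivity
  have hc : Continuous fun r => Y r ^ (1 + σ) := hY.rpow_const fun _ => Or.inr (by linarith)
  -- `E` is the right-hand side of the inequality solved backwards from `b`; it is `C¹`.
  set E : ℝ → ℝ := fun t => Y b - κ * ∫ r in b..t, Y r ^ (1 + σ) with hE
  have hE_eq : ∀ t, E t = Y b + κ * ∫ r in t..b, Y r ^ (1 + σ) := fun t => by
    rw [hE, intervalIntegral.integral_symm b t]; ring
  have hE_pos : ∀ t ≤ b, 0 < E t := fun t ht => by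
    rw [hE_eq]
    have := intervalIntegral.integral_nonneg (μ := volume) ht fun r _ =>
      Real.rpow_nonneg (hY0 r) (1 + σ)
    positivity
  have hE_der : ∀ t, HasDerivAt E (-(κ * Y t ^ (1 + σ))) t := fun t => by
    have := (intervalIntegral.integral_hasDerivAt_right (hc.intervalIntegrable b t)
      (hc.stronglyMeasurableAtFilter _ _) hc.continuousAt).const_mul κ
    simpa using this.const_sub (Y b)
  have hE_pow : ∀ t ≤ b, HasDerivAt (fun t => E t ^ (-σ))
      (-(κ * Y t ^ (1 + σ)) * (-σ) * E t ^ (-σ - 1)) t := fun t ht =>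
    (hE_der t).rpow_const (Or.inl (hE_pos t ht).ne')
  have key := (convex_Icc a b).mul_sub_le_image_sub_of_le_deriv (f := fun t => E t ^ (-σ))
    (C := κ * σ)
    (fun t ht => (hE_pow t ht.2).continuousAt.continuousWithinAt)
    (fun t ht => (hE_pow t (interior_subset ht).2).differentiableAt.differentiableWithinAt)
    (fun t ht => by
      have ht' := interior_subset ht
      rw [(hE_pow t ht'.2).deriv]
      have h1 : E t ^ (1 + σ) ≤ Y t ^ (1 + σ) :=
        Real.rpow_le_rpow (hE_pos t ht'.2).le (by rw [hE_eq]; exact h t ht') (by linarith)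
      have h2 : E t ^ (1 + σ) * E t ^ (-σ - 1) = 1 := by
        rw [← Real.rpow_add (hE_pos t ht'.2), show 1 + σ + (-σ - 1) = 0 by ring,
          Real.rpow_zero]
      have h3 : 0 < E t ^ (-σ - 1) := Real.rpow_pos_of_pos (hE_pos t ht'.2) _
      have h4 : 1 ≤ Y t ^ (1 + σ) * E t ^ (-σ - 1) := by
        have := mul_le_mul_of_nonneg_right h1 h3.le
        rwa [h2] at this
      have : 0 < κ * σ := by positivity
      nlinarith)
    a (left_mem_Icc.2 hab.le) b (right_mem_Icc.2 hab.le) hab.le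
  have hEb : E b = Y b := by simp [hE]
  rw [hEb] at key
  have h5 := Real.rpow_nonneg (hE_pos a hab.le).le (-σ)
  have h6 : κ * σ * (b - a) ≤ Y b ^ (-σ) := by linarith
  have h7 : 0 < κ * σ * (b - a) := by have := sub_pos.2 hab; positivity
  calc Y b = (Y b ^ (-σ)) ^ (-1 / σ) := by
        rw [← Real.rpow_mul hb.le]
        rw [show -σ * (-1 / σ) = 1 by field_simp, Real.rpow_one]
    _ ≤ _ := Real.rpow_le_rpow_of_nonpos h7 h6 (by
        rw [neg_div]
        have : 0 < 1 / σ := by positivity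
        linarith)

/-! ### Steklov averages -/

section steklov

variable {E : Type*} [NormedAddCommGroup E] [NormedSpace ℝ E]

/-- The forward Steklov average `t ↦ h⁻¹ ∫_t^{t+h} f`. -/
noncomputable def steklov (h : ℝ) (f : ℝ → E) (t : ℝ) : E := h⁻¹ • ∫ τ in t..t + h, f τ

lemma steklov_eq_integral_Ioc {h : ℝ} (hh : 0 < h) (f : ℝ → E) (t : ℝ) :
    steklov h f t = h⁻¹ • ∫ r in Ioc 0 h, f (t + r) := by
  rw [steklov, ← intervalIntegral.integral_of_le hh.le, intervalIntegral.integral_comp_add_left,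
    add_zero]

lemma steklov_sub {h : ℝ} {f g : ℝ → E} {t : ℝ} (hf : IntervalIntegrable f volume t (t + h))
    (hg : IntervalIntegrable g volume t (t + h)) :
    steklov h (fun τ => f τ - g τ) t = steklov h f t - steklov h g t := by
  rw [steklov, intervalIntegral.integral_sub hf hg, smul_sub]; rfl

lemma norm_steklov_le {h : ℝ} (hh : 0 < h) {f : ℝ → E} {M : ℝ} (hf : ∀ τ, ‖f τ‖ ≤ M) (t : ℝ) :
    ‖steklov h f t‖ ≤ M := by
  rw [steklov, norm_smul, norm_inv, Real.norm_eq_abs, abs_of_pos hh]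
  have := intervalIntegral.norm_integral_le_of_norm_le_const (a := t) (b := t + h) (f := f)
    (C := M) fun x _ => hf x
  rw [add_sub_cancel_left, abs_of_pos hh] at this
  rw [inv_mul_le_iff₀ hh]
  linarith

lemma tendsto_steklov_of_hasDerivAt {f : ℝ → E} {t : ℝ}
    (ht : HasDerivAt (fun x => ∫ τ in t..x, f τ) (f t) t) :
    Tendsto (fun h => steklov h f t) (𝓝[>] 0) (𝓝 (f t)) := by
  have hsub : Ioi (0 : ℝ) ⊆ {0}ᶜ := fun x (hx : 0 < x) => hx.ne'
  simpa [steklov] using (hasDerivAt_iff_tendsto_slope_zero.1 ht).mono_left (nhdsWithin_mono 0 hsub)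

variable [CompleteSpace E]

lemma hasDerivAt_steklov {f : ℝ → E} (hf : Continuous f) (h t : ℝ) :
    HasDerivAt (steklov h f) (h⁻¹ • (f (t + h) - f t)) t := by
  have h1 : ∀ t, HasDerivAt (fun t => ∫ τ in (0 : ℝ)..t, f τ) (f t) t := fun t =>
    intervalIntegral.integral_hasDerivAt_right (hf.intervalIntegrable _ _)
      (hf.stronglyMeasurableAtFilter _ _) hf.continuousAt
  have h2 : steklov h f = fun t =>
      h⁻¹ • ((∫ τ in (0 : ℝ)..t + h, f τ) - ∫ τ in (0 : ℝ)..t, f τ) := by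
    funext t
    rw [steklov, intervalIntegral.integral_interval_sub_left (hf.intervalIntegrable _ _)
      (hf.intervalIntegrable _ _)]
  rw [h2]
  exact (((h1 (t + h)).comp_add_const t h).sub (h1 t)).const_smul _

lemma contDiff_steklov {f : ℝ → E} (hf : Continuous f) (h : ℝ) : ContDiff ℝ 1 (steklov h f) := by
  rw [contDiff_one_iff_deriv]
  refine ⟨fun t => (hasDerivAt_steklov hf h t).differentiableAt, ?_⟩
  have : deriv (steklov h f) = fun t => h⁻¹ • (f (t + h) - f t) :=
    funext fun t => (hasDerivAt_steklov hf h t).deriv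
  rw [this]
  fun_prop

lemma tendsto_steklov {f : ℝ → E} (hf : Continuous f) (t : ℝ) :
    Tendsto (fun h => steklov h f t) (𝓝[>] 0) (𝓝 (f t)) :=
  tendsto_steklov_of_hasDerivAt (intervalIntegral.integral_hasDerivAt_right
    (hf.intervalIntegrable _ _) (hf.stronglyMeasurableAtFilter _ _) hf.continuousAt)

/-- Lebesgue's differentiation theorem. -/
lemma ae_tendsto_steklov {f : ℝ → E} (hf : LocallyIntegrable f volume) :
    ∀ᵐ t, Tendsto (fun h => steklov h f t) (𝓝[>] 0) (𝓝 (f t)) := by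
  filter_upwards [LocallyIntegrable.ae_hasDerivAt_integral hf] with t ht
  exact tendsto_steklov_of_hasDerivAt (ht t)

end steklov

/-- Discrete chain rule: if `Ψ(t)` is a subgradient at `W(t)` of a convex function whose value
along the curve `W` is `Y`, then the pairing of `W` with the time derivative of the forward
Steklov average of `Ψ` is controlled by boundary terms. Only continuity of the curves is used. -/
lemma integral_inner_deriv_steklov_le {H : Type*} [NormedAddCommGroup H] [InnerProductSpace ℝ H]
    {W Ψ : ℝ → H} {Y : ℝ → ℝ} (hW : Continuous W) (hΨ : Continuous Ψ) (hY : Continuous Y)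
    (hsub : ∀ s t, Y t - Y s ≤ inner ℝ (W t - W s) (Ψ t)) {a b h : ℝ} (hab : a ≤ b) (hh : 0 < h) :
    ∫ t in a..b, inner ℝ (W t) (h⁻¹ • (Ψ (t + h) - Ψ t)) ≤
      steklov h (fun t => inner ℝ (W t) (Ψ t) - Y t) b -
        steklov h (fun t => inner ℝ (W t) (Ψ t) - Y t) a := by
  set Q : ℝ → ℝ := fun t => inner ℝ (W t) (Ψ t) - Y t with hQ
  have hQc : Continuous Q := (hW.inner hΨ).sub hY
  have hi : ∀ c d, IntervalIntegrable Q volume c d := fun c d => hQc.intervalIntegrable c d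
  have h1 : ∀ t, inner ℝ (W t) (h⁻¹ • (Ψ (t + h) - Ψ t)) ≤ h⁻¹ * (Q (t + h) - Q t) := fun t => by
    rw [real_inner_smul_right]
    refine mul_le_mul_of_nonneg_left ?_ (by positivity)
    have := hsub t (t + h)
    rw [inner_sub_left] at this
    rw [inner_sub_right]
    simp only [hQ]
    linarith
  calc ∫ t in a..b, inner ℝ (W t) (h⁻¹ • (Ψ (t + h) - Ψ t))
      ≤ ∫ t in a..b, h⁻¹ * (Q (t + h) - Q t) := by
        refine intervalIntegral.integral_mono_on hab (Continuous.intervalIntegrable ?_ _ _)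
          (Continuous.intervalIntegrable ?_ _ _) fun t _ => h1 t
        · fun_prop
        · fun_prop
    _ = h⁻¹ * ((∫ t in a + h..b + h, Q t) - ∫ t in a..b, Q t) := by
        rw [intervalIntegral.integral_const_mul, intervalIntegral.integral_sub
          (Continuous.intervalIntegrable (by fun_prop) _ _) (hi _ _),
          intervalIntegral.integral_comp_add_right]
    _ = steklov h Q b - steklov h Q a := by
        have := intervalIntegral.integral_add_adjacent_intervals (hi a b) (hi b (b + h))
        have := intervalIntegral.integral_add_adjacent_intervals (hi a (a + h)) (hi (a + h) (b + h))
        simp only [steklov, smul_eq_mul]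
        rw [← mul_sub]
        congr 1
        linarith

/-! ### Convergence of Steklov averages under the space integral -/

lemma rpow_lintegral_le {α : Type*} [MeasurableSpace α] {μ : Measure α} {p : ℝ} (hp : 1 < p)
    {F : α → ℝ≥0∞} (hF : AEMeasurable F μ) :
    (∫⁻ x, F x ∂μ) ^ p ≤ μ univ ^ (p - 1) * ∫⁻ x, F x ^ p ∂μ := by
  have hc := Real.HolderConjugate.conjExponent hp
  have h := ENNReal.lintegral_mul_le_Lp_mul_Lq μ hc hF (aemeasurable_const (b := (1 : ℝ≥0∞)))
  simp only [Pi.mul_apply, mul_one, ENNReal.one_rpow, lintegral_one] at h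
  calc (∫⁻ x, F x ∂μ) ^ p
      ≤ ((∫⁻ x, F x ^ p ∂μ) ^ (1 / p) * μ univ ^ (1 / p.conjExponent)) ^ p :=
        ENNReal.rpow_le_rpow h (by linarith)
    _ = _ := by
        rw [ENNReal.mul_rpow_of_nonneg _ _ (by linarith), ← ENNReal.rpow_mul, ← ENNReal.rpow_mul,
          one_div_mul_cancel (by linarith), ENNReal.rpow_one, mul_comm, Real.conjExponent]
        congr 2
        field_simp

/-- Steklov averages are contractions of `L^p(ℝ)`. -/
lemma lintegral_steklov_rpow_le {p h : ℝ} (hp : 1 < p) (hh : 0 < h) {f : ℝ → ℝ}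
    (hf : Measurable f) : ∫⁻ t, ‖steklov h f t‖ₑ ^ p ≤ ∫⁻ t, ‖f t‖ₑ ^ p := by
  have hh0 : ENNReal.ofReal h ≠ 0 := by simpa using hh
  have h1 : ∀ t, ‖steklov h f t‖ₑ ^ p ≤
      (ENNReal.ofReal h)⁻¹ * ∫⁻ r in Ioc 0 h, ‖f (t + r)‖ₑ ^ p := fun t => by
    rw [steklov_eq_integral_Ioc hh, enorm_smul]
    have e : ‖h⁻¹‖ₑ = (ENNReal.ofReal h)⁻¹ := by
      rw [Real.enorm_of_nonneg (by positivity), ENNReal.ofReal_inv_of_pos hh]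
    rw [e, ENNReal.mul_rpow_of_nonneg _ _ (by linarith)]
    calc (ENNReal.ofReal h)⁻¹ ^ p * ‖∫ r in Ioc 0 h, f (t + r)‖ₑ ^ p
        ≤ (ENNReal.ofReal h)⁻¹ ^ p * ((ENNReal.ofReal h) ^ (p - 1) *
            ∫⁻ r in Ioc 0 h, ‖f (t + r)‖ₑ ^ p) := by
          gcongr
          refine (ENNReal.rpow_le_rpow (enorm_integral_le_lintegral_enorm _) (by linarith)).trans ?_
          have := rpow_lintegral_le (μ := volume.restrict (Ioc 0 h)) hp
            (F := fun r => ‖f (t + r)‖ₑ) (by fun_prop)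
          simpa using this
      _ = _ := by
          rw [← mul_assoc]
          congr 1
          rw [ENNReal.inv_rpow, ← ENNReal.rpow_neg, ← ENNReal.rpow_add _ _ hh0 ENNReal.ofReal_ne_top,
            show -p + (p - 1) = -1 by ring, ENNReal.rpow_neg_one]
  calc ∫⁻ t, ‖steklov h f t‖ₑ ^ p
      ≤ ∫⁻ t, (ENNReal.ofReal h)⁻¹ * ∫⁻ r in Ioc 0 h, ‖f (t + r)‖ₑ ^ p := lintegral_mono h1
    _ = (ENNReal.ofReal h)⁻¹ * ∫⁻ t, ∫⁻ r in Ioc 0 h, ‖f (t + r)‖ₑ ^ p :=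
        lintegral_const_mul' _ _ (by simpa using hh)
    _ = (ENNReal.ofReal h)⁻¹ * ∫⁻ r in Ioc 0 h, ∫⁻ t, ‖f (t + r)‖ₑ ^ p := by
        rw [lintegral_lintegral_swap]
        refine Measurable.aemeasurable ?_
        simp only [Function.uncurry_def]
        fun_prop
    _ = (ENNReal.ofReal h)⁻¹ * ∫⁻ _ in Ioc 0 h, ∫⁻ t, ‖f t‖ₑ ^ p := by
        congr 2
        funext r
        exact lintegral_add_right_eq_self (fun t => ‖f t‖ₑ ^ p) r
    _ = ∫⁻ t, ‖f t‖ₑ ^ p := by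
        rw [setLIntegral_const, Real.volume_Ioc, sub_zero, mul_comm (∫⁻ t, ‖f t‖ₑ ^ p), ← mul_assoc,
          ENNReal.inv_mul_cancel hh0 ENNReal.ofReal_ne_top, one_mul]

section product

variable {Z : Type*} [MeasurableSpace Z]

lemma stronglyMeasurable_steklov {H : ℝ → Z → ℝ} (hH : Measurable (Function.uncurry H)) {h : ℝ}
    (hh : 0 < h) : StronglyMeasurable fun q : ℝ × Z => steklov h (fun τ => H τ q.2) q.1 := by
  simp only [steklov_eq_integral_Ioc hh]
  refine StronglyMeasurable.const_smul (c := h⁻¹) ?_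
  refine StronglyMeasurable.integral_prod_right' (f := fun w : (ℝ × Z) × ℝ => H (w.1.1 + w.2) w.1.2)
    ?_
  refine Measurable.stronglyMeasurable ?_
  exact hH.comp (by fun_prop : Measurable fun w : (ℝ × Z) × ℝ => (w.1.1 + w.2, w.1.2))

/-- Passage to the limit in a pairing with Steklov averages in time, on a product `ℝ × Z`. On
almost every time slice the convergence is dominated, by Lebesgue's differentiation theorem and
boundedness of `H`; the slice integrals are dominated by `B`. -/
lemma tendsto_integral_mul_steklov {ν : Measure Z} [SFinite ν] {F H : ℝ → Z → ℝ} {M : ℝ}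
    {B : Z → ℝ≥0∞} (hF : AEStronglyMeasurable (Function.uncurry F) (volume.prod ν))
    (hH : Measurable (Function.uncurry H)) (hM : ∀ t z, |H t z| ≤ M)
    (hslice : ∀ᵐ z ∂ν, Integrable fun t => F t z)
    (hBm : AEMeasurable B ν) (hB : ∫⁻ z, B z ∂ν ≠ ∞)
    (hbd : ∀ h > 0, ∀ᵐ z ∂ν, ∫⁻ t, ‖F t z * steklov h (fun τ => H τ z) t‖ₑ ≤ B z) :
    (∀ h > 0, Integrable (fun q : ℝ × Z => F q.1 q.2 * steklov h (fun τ => H τ q.2) q.1)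
      (volume.prod ν)) ∧
    Integrable (fun q : ℝ × Z => F q.1 q.2 * H q.1 q.2) (volume.prod ν) ∧
    Tendsto (fun h => ∫ q : ℝ × Z, F q.1 q.2 * steklov h (fun τ => H τ q.2) q.1 ∂volume.prod ν)
      (𝓝[>] 0) (𝓝 (∫ q : ℝ × Z, F q.1 q.2 * H q.1 q.2 ∂volume.prod ν)) := by
  have hmeas : ∀ h > 0, AEStronglyMeasurable
      (fun q : ℝ × Z => F q.1 q.2 * steklov h (fun τ => H τ q.2) q.1) (volume.prod ν) :=
    fun h hh => hF.mul (stronglyMeasurable_steklov hH hh).aestronglyMeasurable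
  have hmeas0 : AEStronglyMeasurable (fun q : ℝ × Z => F q.1 q.2 * H q.1 q.2) (volume.prod ν) :=
    hF.mul hH.aestronglyMeasurable
  have hHz : ∀ z, Measurable fun t => H t z := fun z =>
    hH.comp (by fun_prop : Measurable fun t : ℝ => (t, z))
  have hlim : ∀ᵐ z ∂ν, ∀ᵐ t, Tendsto (fun h => F t z * steklov h (fun τ => H τ z) t) (𝓝[>] 0)
      (𝓝 (F t z * H t z)) := Eventually.of_forall fun z => by
    have hloc : LocallyIntegrable (fun t => H t z) volume :=
      (locallyIntegrable_const M).mono (hHz z).aestronglyMeasurable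
        (Eventually.of_forall fun t => by
          simpa using (hM t z).trans (le_abs_self M))
    filter_upwards [ae_tendsto_steklov hloc] with t ht
    exact ht.const_mul _
  have hbound : ∀ h > 0, ∀ z t, ‖F t z * steklov h (fun τ => H τ z) t‖ ≤ ‖F t z‖ * M :=
    fun h hh z t => by
      rw [norm_mul]
      gcongr
      exact norm_steklov_le hh (fun τ => hM τ z) t
  have hint : ∀ h > 0, Integrable
      (fun q : ℝ × Z => F q.1 q.2 * steklov h (fun τ => H τ q.2) q.1) (volume.prod ν) := by
    intro h hh
    refine ⟨hmeas h hh, ?_⟩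
    rw [HasFiniteIntegral, lintegral_prod_symm _ (hmeas h hh).enorm]
    exact (lintegral_mono_ae (hbd h hh)).trans_lt hB.lt_top
  -- Fatou's lemma on the slices transfers the bound to `H` itself.
  have hbd0 : ∀ᵐ z ∂ν, ∫⁻ t, ‖F t z * H t z‖ₑ ≤ B z := by
    have hseq : ∀ᵐ z ∂ν, ∀ k : ℕ,
        ∫⁻ t, ‖F t z * steklov (1 / ((k : ℝ) + 1)) (fun τ => H τ z) t‖ₑ ≤ B z :=
      ae_all_iff.2 fun k => hbd _ (by positivity)
    filter_upwards [hseq, hlim, hslice] with z h1 h2 h3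
    have h0 : Tendsto (fun k : ℕ => 1 / ((k : ℝ) + 1)) atTop (𝓝[>] 0) :=
      tendsto_nhdsWithin_iff.2 ⟨tendsto_one_div_add_atTop_nhds_zero_nat,
        Eventually.of_forall fun k => by simp only [mem_Ioi]; positivity⟩
    calc ∫⁻ t, ‖F t z * H t z‖ₑ
        ≤ ∫⁻ t, liminf (fun k : ℕ =>
            ‖F t z * steklov (1 / ((k : ℝ) + 1)) (fun τ => H τ z) t‖ₑ) atTop := by
          refine lintegral_mono_ae ?_
          filter_upwards [h2] with t ht
          exact ((ht.comp h0).enorm.liminf_eq).ge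
      _ ≤ liminf (fun k : ℕ =>
            ∫⁻ t, ‖F t z * steklov (1 / ((k : ℝ) + 1)) (fun τ => H τ z) t‖ₑ) atTop := by
          refine lintegral_liminf_le' fun k => ?_
          have : Measurable fun t => steklov (1 / ((k : ℝ) + 1)) (fun τ => H τ z) t :=
            (stronglyMeasurable_steklov hH (by positivity)).measurable.comp
              (by fun_prop : Measurable fun t : ℝ => (t, z))
          exact (h3.aestronglyMeasurable.mul this.aestronglyMeasurable).enorm
      _ ≤ B z := by
          refine (liminf_le_liminf (Eventually.of_forall h1)).trans ?_
          simp
  have hint0 : Integrable (fun q : ℝ × Z => F q.1 q.2 * H q.1 q.2) (volume.prod ν) := by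
    refine ⟨hmeas0, ?_⟩
    rw [HasFiniteIntegral, lintegral_prod_symm _ hmeas0.enorm]
    exact (lintegral_mono_ae hbd0).trans_lt hB.lt_top
  refine ⟨hint, hint0, ?_⟩
  rw [integral_prod_symm _ hint0]
  have heq : (fun h => ∫ z, (∫ t, F t z * steklov h (fun τ => H τ z) t) ∂ν) =ᶠ[𝓝[>] 0]
      fun h => ∫ q : ℝ × Z, F q.1 q.2 * steklov h (fun τ => H τ q.2) q.1 ∂volume.prod ν := by
    filter_upwards [self_mem_nhdsWithin] with h hh
    rw [integral_prod_symm _ (hint h hh)]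
  refine Tendsto.congr' heq ?_
  have hBfin : ∀ᵐ z ∂ν, B z < ∞ := ae_lt_top' hBm hB
  refine tendsto_integral_filter_of_dominated_convergence (fun z => (B z).toReal) ?_ ?_
    (integrable_toReal_of_lintegral_ne_top hBm hB) ?_
  · filter_upwards [self_mem_nhdsWithin] with h hh
    exact (hint h hh).integral_prod_right.aestronglyMeasurable
  · filter_upwards [self_mem_nhdsWithin] with h hh
    filter_upwards [hbd h hh, hBfin] with z h1 h2
    rw [← toReal_enorm]
    exact ENNReal.toReal_mono h2.ne ((enorm_integral_le_lintegral_enorm _).trans h1)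
  · filter_upwards [hlim, hslice] with z h2 h3
    refine tendsto_integral_filter_of_dominated_convergence (fun t => ‖F t z‖ * M) ?_ ?_
      (h3.norm.mul_const M) h2
    · filter_upwards [self_mem_nhdsWithin] with h hh
      have : Measurable fun t => steklov h (fun τ => H τ z) t :=
        (stronglyMeasurable_steklov hH hh).measurable.comp
          (by fun_prop : Measurable fun t : ℝ => (t, z))
      exact h3.aestronglyMeasurable.mul this.aestronglyMeasurable
    · filter_upwards [self_mem_nhdsWithin] with h hh
      exact Eventually.of_forall fun t => hbound h hh z t

end product

/-- The Bochner integral of a curve in `L²` is computed pointwise. -/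
lemma steklov_ae_eq {X : Type*} [MeasurableSpace X] {μ : Measure X} [IsFiniteMeasure μ]
    {ψ : ℝ → X → ℝ} {Ψ : ℝ → Lp ℝ 2 μ} {M h t : ℝ} (hψ : Measurable (Function.uncurry ψ))
    (hM : ∀ t x, |ψ t x| ≤ M) (hΨ : Continuous Ψ) (hh : 0 < h)
    (hae : ∀ᵐ τ ∂volume.restrict (Ioc t (t + h)), Ψ τ =ᵐ[μ] ψ τ) :
    (steklov h Ψ t : Lp ℝ 2 μ) =ᵐ[μ] fun x => steklov h (fun τ => ψ τ x) t := by
  have hrm : StronglyMeasurable fun x => steklov h (fun τ => ψ τ x) t :=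
    (stronglyMeasurable_steklov hψ hh).comp_measurable
      (by fun_prop : Measurable fun x : X => (t, x))
  have hr : MemLp (fun x => steklov h (fun τ => ψ τ x) t) 2 μ :=
    MemLp.of_bound hrm.aestronglyMeasurable M
      (Eventually.of_forall fun x => norm_steklov_le hh (fun τ => hM τ x) t)
  suffices steklov h Ψ t = hr.toLp _ by
    rw [this]; exact hr.coeFn_toLp
  refine ext_inner_left ℝ fun v => ?_
  have hv : Integrable v μ := (Lp.memLp v).integrable one_le_two
  have hle : t ≤ t + h := by linarith
  have h1 : inner ℝ v (steklov h Ψ t) = h⁻¹ * ∫ τ in Ioc t (t + h), ∫ x, v x * ψ τ x ∂μ := by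
    rw [steklov, real_inner_smul_right, intervalIntegral.integral_of_le hle,
      ← integral_inner ((hΨ.integrableOn_Icc).mono_set Ioc_subset_Icc_self)]
    congr 1
    refine integral_congr_ae ?_
    filter_upwards [hae] with τ hτ
    rw [L2.inner_def]
    refine integral_congr_ae ?_
    filter_upwards [hτ] with x hx
    rw [hx]
    simp [mul_comm]
  have h2 : inner ℝ v (hr.toLp _) = h⁻¹ * ∫ x, (∫ τ in Ioc t (t + h), v x * ψ τ x) ∂μ := by
    rw [L2.inner_def, ← integral_const_mul]
    refine integral_congr_ae ?_
    filter_upwards [hr.coeFn_toLp] with x hx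
    rw [hx, integral_const_mul, ← intervalIntegral.integral_of_le hle]
    simp only [steklov, smul_eq_mul, RCLike.inner_apply, conj_trivial]
    ring
  rw [h1, h2]
  congr 1
  refine integral_integral_swap ?_
  have h3 : Integrable (fun q : ℝ × X => v q.2) ((volume.restrict (Ioc t (t + h))).prod μ) :=
    hv.comp_snd _
  exact h3.mul_bdd (c := M) hψ.aestronglyMeasurable (Eventually.of_forall fun q => hM q.1 q.2)

/-! ### The function spaces -/

variable {n : ℕ}

instance (s p : ℝ) : SigmaFinite (fracMeasure n s p) := by
  unfold fracMeasure; infer_instance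

lemma fracMeasure_absolutelyContinuous (s p : ℝ) :
    fracMeasure n s p ≪ (volume : Measure (Eu n)).prod volume :=
  withDensity_absolutelyContinuous _ _

lemma tailMeasure_absolutelyContinuous (α : ℝ) : tailMeasure n α ≪ volume :=
  withDensity_absolutelyContinuous _ _

lemma eLpNorm_rpow_eq_lintegral {X : Type*} [MeasurableSpace X] {μ : Measure X} {p : ℝ}
    (hp : 0 < p) (f : X → ℝ) : eLpNorm f (ENNReal.ofReal p) μ ^ p = ∫⁻ x, ‖f x‖ₑ ^ p ∂μ := by
  rw [eLpNorm_eq_lintegral_rpow_enorm_toReal (by simpa using hp) ENNReal.ofReal_ne_top,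
    ENNReal.toReal_ofReal hp.le, ← ENNReal.rpow_mul, one_div_mul_cancel hp.ne', ENNReal.rpow_one]

lemma memLp_ofReal_iff {X : Type*} [MeasurableSpace X] {μ : Measure X} {p : ℝ}
    (hp : 0 < p) {f : X → ℝ} : MemLp f (ENNReal.ofReal p) μ ↔
      AEStronglyMeasurable f μ ∧ ∫⁻ x, ‖f x‖ₑ ^ p ∂μ < ∞ := by
  rw [MemLp, ← eLpNorm_rpow_eq_lintegral hp, ENNReal.rpow_lt_top_iff_of_pos hp]

lemma sobolevENorm_eq {s p : ℝ} (hp : 0 < p) (A : Set (Eu n)) (g : Eu n → ℝ) :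
    sobolevENorm s p A g = ((∫⁻ x in A, ‖g x‖ₑ ^ p) +
      ∫⁻ z in A ×ˢ A, ‖g z.1 - g z.2‖ₑ ^ p ∂fracMeasure n s p) ^ (1 / p) := by
  rw [sobolevENorm, eLpNorm_rpow_eq_lintegral hp, eLpNorm_rpow_eq_lintegral hp]

lemma sobolevENorm_rpow {s p : ℝ} (hp : 0 < p) (A : Set (Eu n)) (g : Eu n → ℝ) :
    sobolevENorm s p A g ^ p = (∫⁻ x in A, ‖g x‖ₑ ^ p) +
      ∫⁻ z in A ×ˢ A, ‖g z.1 - g z.2‖ₑ ^ p ∂fracMeasure n s p := by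
  rw [sobolevENorm_eq hp, ← ENNReal.rpow_mul, one_div_mul_cancel hp.ne', ENNReal.rpow_one]

/-- Elements of `W_0^{s,p}(Ω)` vanish almost everywhere outside `Ω`. -/
lemma ae_eq_zero_of_mem_sobolevZero {s p : ℝ} (hp : 2 < p) {Ω : Set (Eu n)} (hΩ : IsOpen Ω)
    {g : Eu n → ℝ} (hg : g ∈ sobolevZero s p Ω) :
    ∀ᵐ x ∂(volume : Measure (Eu n)), x ∉ Ω → g x = 0 := by
  have hp0 : 0 < p := by linarith
  have h0 : ∫⁻ x in Ωᶜ, ‖g x‖ₑ ^ p = 0 := by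
    by_contra hne
    obtain ⟨φ, -, -, hφ, hlt⟩ := hg.2 ((∫⁻ x in Ωᶜ, ‖g x‖ₑ ^ p) ^ (1 / p))
      (ENNReal.rpow_pos_of_nonneg (pos_iff_ne_zero.2 hne) (by positivity))
    refine hlt.not_ge ?_
    rw [sobolevENorm_eq hp0, Measure.restrict_univ]
    refine ENNReal.rpow_le_rpow (le_trans ?_ le_self_add) (by positivity)
    refine le_trans (le_of_eq ?_) (setLIntegral_le_lintegral Ωᶜ _)
    refine setLIntegral_congr_fun hΩ.measurableSet.compl fun x hx => ?_
    have : φ x = 0 := image_eq_zero_of_notMem_tsupport fun h => hx (hφ h)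
    simp [this]
  have hgm : AEStronglyMeasurable g volume := by
    have := hg.1.1.aestronglyMeasurable
    rwa [Measure.restrict_univ] at this
  rw [lintegral_eq_zero_iff' (hgm.restrict.enorm.pow_const p),
    EventuallyEq, ae_restrict_iff' hΩ.measurableSet.compl] at h0
  filter_upwards [h0] with x hx hxΩ
  have := hx hxΩ
  simpa [hp0, hp0.le, hp0.not_gt] using this

lemma isFiniteMeasure_tailMeasure {α : ℝ} (hα : 0 < α) : IsFiniteMeasure (tailMeasure n α) := by
  have hr : 0 < (n : ℝ) + α := by positivity
  refine isFiniteMeasure_withDensity_ofReal ?_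
  have h1 := integrable_one_add_norm (E := Eu n) (μ := volume) (r := (n : ℝ) + α) (by simp [hα])
  have h2 := h1.const_mul (2 ^ ((n : ℝ) + α))
  refine (h2.mono' ?_ ?_).2
  · refine (Measurable.inv ?_).aestronglyMeasurable
    fun_prop
  · refine Eventually.of_forall fun x => ?_
    have hx := norm_nonneg x
    have hx' : 0 ≤ ‖x‖ ^ ((n : ℝ) + α) := by positivity
    rw [Real.norm_of_nonneg (by positivity), Real.rpow_neg (by positivity), ← div_eq_mul_inv,
      ← one_div, div_le_div_iff₀ (by positivity) (by positivity), one_mul]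
    -- `1 + r ≤ 2 max(1, r)`
    have h3 : (1 + ‖x‖) ^ ((n : ℝ) + α) ≤ (2 * max 1 ‖x‖) ^ ((n : ℝ) + α) := by
      refine Real.rpow_le_rpow (by positivity) ?_ hr.le
      have := le_max_left 1 ‖x‖
      have := le_max_right 1 ‖x‖
      linarith
    rw [Real.mul_rpow two_pos.le (by positivity)] at h3
    refine h3.trans ?_
    gcongr
    rcases max_choice 1 ‖x‖ with h | h <;> rw [h]
    · simpa using hx'
    · linarith

/-! ### Test functions -/

lemma intervalIntegrable_of_bounded {f : ℝ → ℝ} (hf : Measurable f) {M : ℝ} (hM : ∀ t, |f t| ≤ M)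
    (a b : ℝ) : IntervalIntegrable f volume a b := by
  rw [intervalIntegrable_iff]
  exact Measure.integrableOn_of_bounded (M := M) (by simp) hf.aestronglyMeasurable
    (Eventually.of_forall hM)

lemma measurable_slice {X : Type*} [MeasurableSpace X] {ψ : ℝ → X → ℝ}
    (hψ : Measurable (Function.uncurry ψ)) (x : X) : Measurable fun t => ψ t x :=
  hψ.comp (by fun_prop : Measurable fun t : ℝ => (t, x))

lemma measurable_difference {X : Type*} [MeasurableSpace X] {ψ : ℝ → X → ℝ}
    (hψ : Measurable (Function.uncurry ψ)) :
    Measurable (Function.uncurry fun (t : ℝ) (z : X × X) => ψ t z.1 - ψ t z.2) :=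
  (hψ.comp (by fun_prop : Measurable fun q : ℝ × X × X => (q.1, q.2.1))).sub
    (hψ.comp (by fun_prop : Measurable fun q : ℝ × X × X => (q.1, q.2.2)))

lemma steklov_difference {X : Type*} [MeasurableSpace X] {ψ : ℝ → X → ℝ}
    (hψ : Measurable (Function.uncurry ψ)) {M : ℝ} (hM : ∀ t x, |ψ t x| ≤ M) (h t : ℝ) (x y : X) :
    steklov h (fun τ => ψ τ x) t - steklov h (fun τ => ψ τ y) t =
      steklov h (fun τ => ψ τ x - ψ τ y) t :=
  (steklov_sub (intervalIntegrable_of_bounded (measurable_slice hψ x) (hM · x) _ _)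
    (intervalIntegrable_of_bounded (measurable_slice hψ y) (hM · y) _ _)).symm

/-- The Steklov average of a bounded function with values in `X_0^{s,p}(Ω, Ω')` is an admissible
test function, as far as its space regularity is concerned. -/
lemma memBochner_steklov {s p : ℝ} (hs : 0 < s) (hp : 2 < p) {Ω Ω' : Set (Eu n)}
    (hΩ'b : Bornology.IsBounded Ω') {ψ : ℝ → Eu n → ℝ} (hψ : Measurable (Function.uncurry ψ))
    {M : ℝ} (hM : ∀ t x, |ψ t x| ≤ M) (hψΩ : ∀ t, ∀ x ∉ Ω, ψ t x = 0)
    (hfin : ∫⁻ z in Ω' ×ˢ Ω', (∫⁻ t, ‖ψ t z.1 - ψ t z.2‖ₑ ^ p) ∂fracMeasure n s p < ∞)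
    {a b h : ℝ} (hh : 0 < h) :
    MemBochner p (Icc a b) (X0 s p Ω Ω') (sobolevENorm s p Ω')
      fun t x => steklov h (fun τ => ψ τ x) t := by
  have hp0 : 0 < p := by linarith
  set φ : ℝ → Eu n → ℝ := fun t x => steklov h (fun τ => ψ τ x) t with hφ
  have hφm : Measurable (Function.uncurry φ) := (stronglyMeasurable_steklov hψ hh).measurable
  have hφM : ∀ t x, ‖φ t x‖ ≤ M := fun t x => norm_steklov_le hh (fun τ => hM τ x) t
  have hφt : ∀ t, Measurable (φ t) := fun t =>
    hφm.comp (by fun_prop : Measurable fun x : Eu n => (t, x))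
  have hDm := measurable_difference hφm
  have hD : ∀ t (z : Eu n × Eu n), φ t z.1 - φ t z.2 = steklov h (fun τ => ψ τ z.1 - ψ τ z.2) t :=
    fun t z => steklov_difference hψ hM h t z.1 z.2
  have hm1 : Measurable fun t => ∫⁻ x in Ω', ‖φ t x‖ₑ ^ p :=
    Measurable.lintegral_prod_right' (f := fun q : ℝ × Eu n => ‖φ q.1 q.2‖ₑ ^ p)
      (hφm.enorm.pow_const p)
  have hm2 : Measurable fun t =>
      ∫⁻ z in Ω' ×ˢ Ω', ‖φ t z.1 - φ t z.2‖ₑ ^ p ∂fracMeasure n s p :=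
    Measurable.lintegral_prod_right'
      (f := fun q : ℝ × Eu n × Eu n => ‖φ q.1 q.2.1 - φ q.1 q.2.2‖ₑ ^ p) (hDm.enorm.pow_const p)
  have hN : Measurable fun t => sobolevENorm s p Ω' (φ t) := by
    simp only [sobolevENorm_eq hp0]
    exact (hm1.add hm2).pow_const _
  have hfin' : ∫⁻ t in Icc a b, sobolevENorm s p Ω' (φ t) ^ p < ∞ := by
    simp only [sobolevENorm_rpow hp0]
    rw [lintegral_add_left hm1]
    refine ENNReal.add_lt_top.2 ⟨?_, ?_⟩
    · calc ∫⁻ t in Icc a b, ∫⁻ x in Ω', ‖φ t x‖ₑ ^ p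
          ≤ ∫⁻ _ in Icc a b, ∫⁻ _ in Ω', ENNReal.ofReal M ^ p := by
            gcongr with t x
            rw [← ofReal_norm]
            exact ENNReal.ofReal_le_ofReal (hφM t x)
        _ < ∞ := by
            simp only [setLIntegral_const]
            have h1 : ENNReal.ofReal M ^ p < ∞ :=
              ENNReal.rpow_lt_top_of_nonneg hp0.le ENNReal.ofReal_ne_top
            exact ENNReal.mul_lt_top (ENNReal.mul_lt_top h1 hΩ'b.measure_lt_top) (by simp)
    · calc ∫⁻ t in Icc a b, ∫⁻ z in Ω' ×ˢ Ω', ‖φ t z.1 - φ t z.2‖ₑ ^ p ∂fracMeasure n s p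
          ≤ ∫⁻ t, ∫⁻ z in Ω' ×ˢ Ω', ‖φ t z.1 - φ t z.2‖ₑ ^ p ∂fracMeasure n s p :=
            setLIntegral_le_lintegral _ _
        _ = ∫⁻ z in Ω' ×ˢ Ω', (∫⁻ t, ‖φ t z.1 - φ t z.2‖ₑ ^ p) ∂fracMeasure n s p :=
            lintegral_lintegral_swap (hDm.enorm.pow_const p).aemeasurable
        _ ≤ ∫⁻ z in Ω' ×ˢ Ω', (∫⁻ t, ‖ψ t z.1 - ψ t z.2‖ₑ ^ p) ∂fracMeasure n s p := by
            refine lintegral_mono fun z => ?_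
            simp only [hD]
            exact lintegral_steklov_rpow_le (by linarith) hh
              (measurable_slice (measurable_difference hψ) z)
        _ < ∞ := hfin
  refine ⟨hφm.aestronglyMeasurable, ?_, hN.aemeasurable, hfin'⟩
  have hlt := ae_lt_top' (hN.pow_const p).aemeasurable hfin'.ne
  filter_upwards [hlt] with t ht
  rw [sobolevENorm_rpow hp0, ENNReal.add_lt_top] at ht
  refine ⟨⟨⟨?_, ?_⟩, ?_⟩, ?_⟩
  · exact (memLp_ofReal_iff hp0).2 ⟨(hφt t).aestronglyMeasurable, ht.1⟩
  · exact (memLp_ofReal_iff hp0).2 ⟨(hDm.comp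
      (by fun_prop : Measurable fun z : Eu n × Eu n => (t, z))).aestronglyMeasurable, ht.2⟩
  · have := isFiniteMeasure_tailMeasure (n := n) (α := s * p) (by positivity)
    exact MemLp.of_bound (hφt t).aestronglyMeasurable M (Eventually.of_forall (hφM t))
  · change ∀ᵐ x ∂volume, x ∉ Ω → φ t x = 0
    exact Eventually.of_forall fun x hx => by simp [hφ, steklov, hψΩ _ x hx]

/-! ### Integrability of the nonlinear flux -/

lemma aestronglyMeasurable_difference {μ : Measure ℝ} [SFinite μ] {ν : Measure (Eu n × Eu n)}
    [SFinite ν] (hν : ν ≪ volume.prod volume) {u : ℝ → Eu n → ℝ}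
    (hu : AEStronglyMeasurable (fun q : ℝ × Eu n => u q.1 q.2) (μ.prod volume)) :
    AEStronglyMeasurable (fun q : ℝ × Eu n × Eu n => u q.1 q.2.1 - u q.1 q.2.2) (μ.prod ν) := by
  have hid : Measure.QuasiMeasurePreserving (id : ℝ → ℝ) μ μ := Measure.QuasiMeasurePreserving.id μ
  have h1 : Measure.QuasiMeasurePreserving (Prod.map id Prod.fst : ℝ × Eu n × Eu n → ℝ × Eu n)
      (μ.prod (volume.prod volume)) (μ.prod volume) :=
    QuasiMeasurePreserving.prodMap hid Measure.quasiMeasurePreserving_fst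
  have h2 : Measure.QuasiMeasurePreserving (Prod.map id Prod.snd : ℝ × Eu n × Eu n → ℝ × Eu n)
      (μ.prod (volume.prod volume)) (μ.prod volume) :=
    QuasiMeasurePreserving.prodMap hid Measure.quasiMeasurePreserving_snd
  exact ((hu.comp_quasiMeasurePreserving h1).sub (hu.comp_quasiMeasurePreserving h2)).mono_ac
    (Measure.AbsolutelyContinuous.rfl.prod hν)

/-- The part of `ℝⁿ × ℝⁿ` in which one point lies in `Ω` and the other one outside `Ω'`. -/
def crossSet (Ω Ω' : Set (Eu n)) : Set (Eu n × Eu n) := Ω ×ˢ Ω'ᶜ ∪ Ω'ᶜ ×ˢ Ω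

lemma measurableSet_crossSet {Ω Ω' : Set (Eu n)} (hΩ : IsOpen Ω) (hΩ' : IsOpen Ω') :
    MeasurableSet (crossSet Ω Ω') :=
  (hΩ.measurableSet.prod hΩ'.measurableSet.compl).union
    (hΩ'.measurableSet.compl.prod hΩ.measurableSet)

lemma norm_sub_rpow_neg_le {α R d : ℝ} (hα : 0 < α) (hR : 0 ≤ R) (hd : 0 < d) {x y : Eu n}
    (hx : ‖x‖ ≤ R) (hxy : d ≤ ‖x - y‖) :
    ‖x - y‖ ^ (-α) ≤ (1 + R ^ α) * (d⁻¹ ^ α + (R / d + 1) ^ α) *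
      ((1 + ‖x‖ ^ α)⁻¹ * (1 + ‖y‖ ^ α)⁻¹) := by
  have hpos : 0 < ‖x - y‖ := hd.trans_le hxy
  have hx0 := norm_nonneg x
  have hy0 := norm_nonneg y
  have h1 : 1 + ‖x‖ ^ α ≤ 1 + R ^ α := by gcongr
  have h2 : ‖y‖ ≤ (R / d + 1) * ‖x - y‖ := by
    have e1 : ‖y‖ ≤ ‖x‖ + ‖x - y‖ := by
      have := norm_sub_le x (x - y)
      simpa using this
    have e2 : R ≤ R / d * ‖x - y‖ := by
      rw [div_mul_eq_mul_div, le_div_iff₀ hd]; gcongr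
    linarith
  have h3 : ‖y‖ ^ α ≤ (R / d + 1) ^ α * ‖x - y‖ ^ α := by
    rw [← Real.mul_rpow (by positivity) hpos.le]
    gcongr
  have h4 : 1 ≤ d⁻¹ ^ α * ‖x - y‖ ^ α := by
    rw [← Real.mul_rpow (by positivity) hpos.le]
    refine Real.one_le_rpow ?_ hα.le
    rw [inv_mul_eq_div, one_le_div hd]
    exact hxy
  have h5 : 1 + ‖y‖ ^ α ≤ (d⁻¹ ^ α + (R / d + 1) ^ α) * ‖x - y‖ ^ α := by linarith
  rw [Real.rpow_neg hpos.le, ← mul_inv, ← div_eq_mul_inv, ← one_div,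
    div_le_div_iff₀ (by positivity) (by positivity), one_mul]
  calc (1 + ‖x‖ ^ α) * (1 + ‖y‖ ^ α)
      ≤ (1 + R ^ α) * ((d⁻¹ ^ α + (R / d + 1) ^ α) * ‖x - y‖ ^ α) := by gcongr
    _ = _ := by ring

/-- Between `Ω` and the complement of `Ω'` the singular kernel is dominated by the product of the
tail weights. -/
lemma exists_fracMeasure_restrict_le {s p : ℝ} (hs : 0 < s) (hp : 2 < p) {Ω Ω' : Set (Eu n)}
    (hΩ : IsOpen Ω) (hΩb : Bornology.IsBounded Ω) (hΩ' : IsOpen Ω') (hsub : closure Ω ⊆ Ω') :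
    ∃ C : ℝ, (fracMeasure n s p).restrict (crossSet Ω Ω') ≤
      ENNReal.ofReal C • (tailMeasure n (s * p)).prod (tailMeasure n (s * p)) := by
  obtain ⟨d, hd, hthick⟩ := hΩb.isCompact_closure.exists_thickening_subset_open hΩ' hsub
  obtain ⟨R, hR⟩ := hΩb.exists_norm_le
  have hα : 0 < (n : ℝ) + s * p := by positivity
  set α := (n : ℝ) + s * p with hαdef
  set R' := max R 0
  have hdist : ∀ x ∈ Ω, ∀ y ∈ Ω'ᶜ, d ≤ ‖x - y‖ := fun x hx y hy => by
    by_contra! hlt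
    refine hy (hthick (Metric.mem_thickening_iff.2 ⟨x, subset_closure hx, ?_⟩))
    rwa [dist_eq_norm, norm_sub_rev]
  have hRx : ∀ x ∈ Ω, ‖x‖ ≤ R' := fun x hx => (hR x hx).trans (le_max_left _ _)
  set C := (1 + R' ^ α) * (d⁻¹ ^ α + (R' / d + 1) ^ α) with hC
  have hR' : 0 ≤ R' := le_max_right _ _
  have hC0 : 0 ≤ C := by positivity
  refine ⟨C, ?_⟩
  have hwm : Measurable fun x : Eu n => ENNReal.ofReal ((1 + ‖x‖ ^ α)⁻¹) := by fun_prop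
  have e1 : (tailMeasure n (s * p)).prod (tailMeasure n (s * p)) =
      ((volume : Measure (Eu n)).prod volume).withDensity fun z =>
        ENNReal.ofReal ((1 + ‖z.1‖ ^ α)⁻¹) * ENNReal.ofReal ((1 + ‖z.2‖ ^ α)⁻¹) := by
    unfold tailMeasure
    rw [prod_withDensity hwm hwm]
  have hm := measurableSet_crossSet hΩ hΩ'
  rw [e1, fracMeasure, restrict_withDensity hm, ← withDensity_smul' _ _ ENNReal.ofReal_ne_top,
    ← withDensity_indicator hm]
  refine withDensity_mono (Eventually.of_forall fun z => indicator_le (fun z hz => ?_) z)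
  simp only [Pi.smul_apply, smul_eq_mul]
  rw [← ENNReal.ofReal_mul (by positivity), ← ENNReal.ofReal_mul hC0]
  refine ENNReal.ofReal_le_ofReal ?_
  rcases hz with ⟨hx, hy⟩ | ⟨hy, hx⟩
  · exact norm_sub_rpow_neg_le hα hR' hd (hRx _ hx) (hdist _ hx _ hy)
  · rw [norm_sub_rev, mul_comm (1 + ‖z.1‖ ^ α)⁻¹]
    exact norm_sub_rpow_neg_le hα hR' hd (hRx _ hx) (hdist _ hx _ hy)

lemma lintegral_difference_lt_top {s p : ℝ} (hp : 2 < p) {A : Set (Eu n)} {I : Set ℝ}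
    {V : Set (Eu n → ℝ)} {u : ℝ → Eu n → ℝ} (hu : MemBochner p I V (sobolevENorm s p A) u) :
    ∫⁻ z in A ×ˢ A, (∫⁻ t in I, ‖u t z.1 - u t z.2‖ₑ ^ p) ∂fracMeasure n s p < ∞ := by
  have hp0 : 0 < p := by linarith
  have hm := aestronglyMeasurable_difference (ν := (fracMeasure n s p).restrict (A ×ˢ A))
    (Measure.absolutelyContinuous_of_le Measure.restrict_le_self |>.trans
      (fracMeasure_absolutelyContinuous s p)) hu.1
  rw [lintegral_lintegral_swap (f := fun (z : Eu n × Eu n) t => ‖u t z.1 - u t z.2‖ₑ ^ p)]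
  · refine lt_of_le_of_lt (lintegral_mono fun t => ?_) hu.2.2.2
    rw [sobolevENorm_rpow hp0]
    exact le_add_self
  · exact ((hm.enorm.pow_const p).comp_quasiMeasurePreserving
      Measure.measurePreserving_swap.quasiMeasurePreserving)

lemma lintegral_cross_difference_lt_top {s p : ℝ} (hs : 0 < s) (hp : 2 < p) {Ω Ω' : Set (Eu n)}
    (hΩ : IsOpen Ω) (hΩb : Bornology.IsBounded Ω) (hΩ' : IsOpen Ω') (hsub : closure Ω ⊆ Ω')
    {I : Set ℝ} {u : ℝ → Eu n → ℝ}
    (hu : MemBochner (p - 1) I (tailSpace n (p - 1) (s * p)) (tailENorm (p - 1) (s * p)) u) :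
    ∫⁻ z in crossSet Ω Ω', (∫⁻ t in I, ‖u t z.1 - u t z.2‖ₑ ^ (p - 1)) ∂fracMeasure n s p < ∞ := by
  have hp0 : 0 < p - 1 := by linarith
  obtain ⟨C, hC⟩ := exists_fracMeasure_restrict_le hs hp hΩ hΩb hΩ' hsub
  set τ := tailMeasure n (s * p) with hτ
  have hfin : IsFiniteMeasure τ := isFiniteMeasure_tailMeasure (by positivity)
  have hm := aestronglyMeasurable_difference (ν := τ.prod τ)
    ((tailMeasure_absolutelyContinuous _).prod (tailMeasure_absolutelyContinuous _)) hu.1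
  have hslice : ∀ᵐ t ∂volume.restrict I, ∫⁻ z, ‖u t z.1 - u t z.2‖ₑ ^ (p - 1) ∂τ.prod τ ≤
      2 ^ (p - 1 - 1) * (2 * τ univ) * tailENorm (p - 1) (s * p) (u t) ^ (p - 1) := by
    filter_upwards [hu.2.1] with t ht
    have hut : AEStronglyMeasurable (u t) τ := MemLp.aestronglyMeasurable ht
    have hm' : AEMeasurable (fun x => ‖u t x‖ₑ ^ (p - 1)) τ := hut.enorm.pow_const _
    calc ∫⁻ z, ‖u t z.1 - u t z.2‖ₑ ^ (p - 1) ∂τ.prod τ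
        ≤ ∫⁻ z, 2 ^ (p - 1 - 1) * (‖u t z.1‖ₑ ^ (p - 1) + ‖u t z.2‖ₑ ^ (p - 1)) ∂τ.prod τ := by
          refine lintegral_mono fun z => ?_
          refine le_trans ?_ (ENNReal.rpow_add_le_mul_rpow_add_rpow _ _ (by linarith))
          gcongr
          exact enorm_sub_le
      _ = 2 ^ (p - 1 - 1) * ((∫⁻ z, ‖u t z.1‖ₑ ^ (p - 1) ∂τ.prod τ) +
            ∫⁻ z, ‖u t z.2‖ₑ ^ (p - 1) ∂τ.prod τ) := by
          rw [lintegral_const_mul' _ _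
            (ENNReal.rpow_ne_top_of_nonneg (by linarith) ENNReal.ofNat_ne_top), lintegral_add_left']
          exact hm'.comp_quasiMeasurePreserving Measure.quasiMeasurePreserving_fst
      _ = _ := by
          have e1 : ∫⁻ z, ‖u t z.1‖ₑ ^ (p - 1) ∂τ.prod τ =
              τ univ * ∫⁻ x, ‖u t x‖ₑ ^ (p - 1) ∂τ := by
            rw [lintegral_prod_symm (fun z : Eu n × Eu n => ‖u t z.1‖ₑ ^ (p - 1))
              (hm'.comp_quasiMeasurePreserving Measure.quasiMeasurePreserving_fst)]
            simp [mul_comm]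
          have e2 : ∫⁻ z, ‖u t z.2‖ₑ ^ (p - 1) ∂τ.prod τ =
              τ univ * ∫⁻ x, ‖u t x‖ₑ ^ (p - 1) ∂τ := by
            rw [lintegral_prod (fun z : Eu n × Eu n => ‖u t z.2‖ₑ ^ (p - 1))
              (hm'.comp_quasiMeasurePreserving Measure.quasiMeasurePreserving_snd)]
            simp [mul_comm]
          rw [e1, e2, tailENorm, eLpNorm_rpow_eq_lintegral hp0]
          ring
  calc ∫⁻ z in crossSet Ω Ω', (∫⁻ t in I, ‖u t z.1 - u t z.2‖ₑ ^ (p - 1)) ∂fracMeasure n s p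
      ≤ ∫⁻ z, (∫⁻ t in I, ‖u t z.1 - u t z.2‖ₑ ^ (p - 1)) ∂(ENNReal.ofReal C • τ.prod τ) :=
        lintegral_mono' hC le_rfl
    _ = ENNReal.ofReal C * ∫⁻ t in I, ∫⁻ z, ‖u t z.1 - u t z.2‖ₑ ^ (p - 1) ∂τ.prod τ := by
        rw [lintegral_smul_measure, smul_eq_mul,
          lintegral_lintegral_swap (f := fun (z : Eu n × Eu n) t => ‖u t z.1 - u t z.2‖ₑ ^ (p - 1))]
        exact ((hm.enorm.pow_const (p - 1)).comp_quasiMeasurePreserving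
          Measure.measurePreserving_swap.quasiMeasurePreserving)
    _ ≤ ENNReal.ofReal C * (2 ^ (p - 1 - 1) * (2 * τ univ) *
          ∫⁻ t in I, tailENorm (p - 1) (s * p) (u t) ^ (p - 1)) := by
        gcongr
        refine (lintegral_mono_ae hslice).trans (le_of_eq ?_)
        refine lintegral_const_mul' _ _ (ENNReal.mul_ne_top ?_ ?_)
        · exact ENNReal.rpow_ne_top_of_nonneg (by linarith) ENNReal.ofNat_ne_top
        · exact ENNReal.mul_ne_top ENNReal.ofNat_ne_top (measure_ne_top _ _)
    _ < ∞ := by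
        refine ENNReal.mul_lt_top ENNReal.ofReal_lt_top (ENNReal.mul_lt_top (ENNReal.mul_lt_top
          ?_ (ENNReal.mul_lt_top ENNReal.ofNat_lt_top (measure_lt_top _ _))) hu.2.2.2)
        exact ENNReal.rpow_lt_top_of_nonneg (by linarith) ENNReal.ofNat_ne_top

lemma enorm_J {p : ℝ} (hp : 2 < p) (t : ℝ) : ‖J p t‖ₑ = ‖t‖ₑ ^ (p - 1) := by
  rw [Real.enorm_eq_ofReal_abs, Real.enorm_eq_ofReal_abs, abs_J hp,
    ENNReal.ofReal_rpow_of_nonneg (abs_nonneg t) (by linarith)]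

lemma rpow_sub_one_mul_le {p : ℝ} (hp : 1 ≤ p) (x y : ℝ≥0∞) :
    x ^ (p - 1) * y ≤ x ^ p + y ^ p := by
  have h : ∀ x : ℝ≥0∞, x ^ (p - 1) * x = x ^ p := fun x => by
    conv_rhs => rw [← sub_add_cancel p 1]
    rw [ENNReal.rpow_add_of_nonneg _ _ (by linarith) zero_le_one, ENNReal.rpow_one]
  rcases le_total y x with hxy | hxy
  · calc x ^ (p - 1) * y ≤ x ^ (p - 1) * x := by gcongr
      _ ≤ _ := by rw [h]; exact le_self_add
  · calc x ^ (p - 1) * y ≤ y ^ (p - 1) * y := by gcongr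
      _ ≤ _ := by rw [h]; exact le_add_self

lemma rpow_sub_one_le {p : ℝ} (hp : 1 ≤ p) (x : ℝ≥0∞) : x ^ (p - 1) ≤ x ^ p + 1 := by
  simpa using rpow_sub_one_mul_le hp x 1

/-- The diffusion term of the weak formulation, tested with Steklov averages `φ_h` of a bounded
function `ψ` supported in `Ω`, converges as `h → 0`. On `Ω' × Ω'` the flux lies in `L^{p'}` and
the differences of `ψ` in `L^p`; between `Ω` and the complement of `Ω'` the flux is integrable
and `ψ` is bounded; elsewhere the differences of `ψ` vanish. -/
lemma tendsto_diffusion_steklov {s p : ℝ} (hs : 0 < s) (hp : 2 < p) {Ω Ω' : Set (Eu n)}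
    (hΩ : IsOpen Ω) (hΩb : Bornology.IsBounded Ω) (hΩ' : IsOpen Ω') (hsub : closure Ω ⊆ Ω')
    {a b : ℝ} {V : Set (Eu n → ℝ)} {u : ℝ → Eu n → ℝ}
    (hu : MemBochner p (Icc a b) V (sobolevENorm s p Ω') u)
    (hu' : MemBochner (p - 1) (Icc a b) (tailSpace n (p - 1) (s * p))
      (tailENorm (p - 1) (s * p)) u)
    {ψ : ℝ → Eu n → ℝ} (hψ : Measurable (Function.uncurry ψ))
    {M : ℝ} (hM : ∀ t x, |ψ t x| ≤ M) (hψΩ : ∀ t, ∀ x ∉ Ω, ψ t x = 0)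
    (hfin : ∫⁻ z in Ω' ×ˢ Ω', (∫⁻ t, ‖ψ t z.1 - ψ t z.2‖ₑ ^ p) ∂fracMeasure n s p < ∞) :
    Integrable (fun q : ℝ × Eu n × Eu n =>
        J p (u q.1 q.2.1 - u q.1 q.2.2) * (ψ q.1 q.2.1 - ψ q.1 q.2.2))
      ((volume.restrict (Icc a b)).prod (fracMeasure n s p)) ∧
    Tendsto (fun h => ∫ t in Icc a b, ∫ z : Eu n × Eu n, J p (u t z.1 - u t z.2) *
        (steklov h (fun τ => ψ τ z.1) t - steklov h (fun τ => ψ τ z.2) t) ∂fracMeasure n s p)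
      (𝓝[>] 0) (𝓝 (∫ q : ℝ × Eu n × Eu n,
        J p (u q.1 q.2.1 - u q.1 q.2.2) * (ψ q.1 q.2.1 - ψ q.1 q.2.2)
          ∂(volume.restrict (Icc a b)).prod (fracMeasure n s p))) := by
  have hp1 : 1 ≤ p := by linarith
  have hΩΩ' : Ω ⊆ Ω' := subset_closure.trans hsub
  set ν := fracMeasure n s p with hν
  set I := Icc a b with hI
  set S₁ : Set (Eu n × Eu n) := Ω' ×ˢ Ω' with hS₁
  set S₂ := crossSet Ω Ω' with hS₂
  have hS₁m : MeasurableSet S₁ := hΩ'.measurableSet.prod hΩ'.measurableSet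
  have hS₂m : MeasurableSet S₂ := measurableSet_crossSet hΩ hΩ'
  have hIm : MeasurableSet I := measurableSet_Icc
  set D : ℝ → Eu n × Eu n → ℝ := fun t z => u t z.1 - u t z.2 with hD
  set H : ℝ → Eu n × Eu n → ℝ := fun t z => ψ t z.1 - ψ t z.2 with hH
  have hHm : Measurable (Function.uncurry H) := measurable_difference hψ
  have hHM : ∀ t z, |H t z| ≤ M + M := fun t z =>
    (abs_sub _ _).trans (add_le_add (hM t z.1) (hM t z.2))
  have hDm : AEStronglyMeasurable (Function.uncurry D) ((volume.restrict I).prod ν) :=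
    aestronglyMeasurable_difference (fracMeasure_absolutelyContinuous s p) hu.1
  set F : ℝ → Eu n × Eu n → ℝ :=
    fun t z => (I ×ˢ (S₁ ∪ S₂)).indicator (fun q : ℝ × Eu n × Eu n => J p (D q.1 q.2)) (t, z)
    with hF
  have hJDm : AEStronglyMeasurable (fun q : ℝ × Eu n × Eu n => J p (D q.1 q.2))
      ((volume.restrict I).prod ν) :=
    (continuous_J hp).comp_aestronglyMeasurable hDm
  have hFm : AEStronglyMeasurable (Function.uncurry F) (volume.prod ν) := by
    change AEStronglyMeasurable ((I ×ˢ (S₁ ∪ S₂)).indicator _) _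
    rw [aestronglyMeasurable_indicator_iff (hIm.prod (hS₁m.union hS₂m)), ← Measure.prod_restrict]
    exact hJDm.mono_measure (Measure.prod_mono le_rfl Measure.restrict_le_self)
  have hF_out : ∀ t z, z ∉ S₁ ∪ S₂ → F t z = 0 := fun t z hz =>
    indicator_of_notMem (fun h => hz h.2) _
  have hF_le : ∀ t z, ‖F t z‖ₑ ≤ I.indicator (fun t => ‖D t z‖ₑ ^ (p - 1)) t := fun t z => by
    by_cases h : (t, z) ∈ I ×ˢ (S₁ ∪ S₂)
    · rw [hF]
      simp only [indicator_of_mem h, indicator_of_mem h.1, enorm_J hp, le_refl]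
    · simp only [hF, indicator_of_notMem h, enorm_zero, zero_le]
  set K₁ : Eu n × Eu n → ℝ≥0∞ := fun z => ∫⁻ t in I, ‖D t z‖ₑ ^ p with hK₁
  set K₂ : Eu n × Eu n → ℝ≥0∞ := fun z => ∫⁻ t in I, ‖D t z‖ₑ ^ (p - 1) with hK₂
  set K₃ : Eu n × Eu n → ℝ≥0∞ := fun z => ∫⁻ t, ‖H t z‖ₑ ^ p with hK₃
  have hKm : ∀ r : ℝ, AEMeasurable (fun z => ∫⁻ t in I, ‖D t z‖ₑ ^ r) ν := fun r =>
    ((hDm.enorm.pow_const r).comp_quasiMeasurePreserving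
      Measure.measurePreserving_swap.quasiMeasurePreserving).lintegral_prod_right'
  have hK₃m : Measurable K₃ := Measurable.lintegral_prod_left' (hHm.enorm.pow_const p)
  have hK₁fin : ∫⁻ z in S₁, K₁ z ∂ν < ∞ := lintegral_difference_lt_top hp hu
  have hK₂fin : ∫⁻ z in S₂, K₂ z ∂ν < ∞ :=
    lintegral_cross_difference_lt_top hs hp hΩ hΩb hΩ' hsub hu'
  set B : Eu n × Eu n → ℝ≥0∞ := fun z => S₁.indicator (fun z => K₁ z + K₃ z) z +
    S₂.indicator (fun z => K₂ z * ENNReal.ofReal (M + M)) z with hB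
  have hB₁m : AEMeasurable (S₁.indicator fun z => K₁ z + K₃ z) ν :=
    ((hKm p).add hK₃m.aemeasurable).indicator hS₁m
  have hB₂m : AEMeasurable (S₂.indicator fun z => K₂ z * ENNReal.ofReal (M + M)) ν :=
    ((hKm (p - 1)).mul_const _).indicator hS₂m
  have hBfin : ∫⁻ z, B z ∂ν ≠ ∞ := by
    rw [hB, lintegral_add_left' hB₁m, lintegral_indicator hS₁m, lintegral_indicator hS₂m,
      lintegral_add_right _ hK₃m, lintegral_mul_const' _ _ ENNReal.ofReal_ne_top]
    exact (ENNReal.add_lt_top.2 ⟨ENNReal.add_lt_top.2 ⟨hK₁fin, hfin⟩,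
      ENNReal.mul_lt_top hK₂fin ENNReal.ofReal_lt_top⟩).ne
  have hslice : ∀ᵐ z ∂ν, Integrable fun t => F t z := by
    have hm := (hFm.comp_quasiMeasurePreserving
      (Measure.measurePreserving_swap (μ := ν)).quasiMeasurePreserving).prodMk_left
    have h1 : ∀ᵐ z ∂ν, z ∈ S₁ → K₁ z < ∞ :=
      (ae_restrict_iff' hS₁m).1 (ae_lt_top' (hKm p).restrict hK₁fin.ne)
    have h2 : ∀ᵐ z ∂ν, z ∈ S₂ → K₂ z < ∞ :=
      (ae_restrict_iff' hS₂m).1 (ae_lt_top' (hKm (p - 1)).restrict hK₂fin.ne)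
    filter_upwards [hm, h1, h2] with z hz h1 h2
    refine ⟨hz, ?_⟩
    by_cases hzS : z ∈ S₁ ∪ S₂
    · have hle : ∫⁻ t, ‖F t z‖ₑ ≤ K₂ z := by
        refine (lintegral_mono fun t => hF_le t z).trans ?_
        rw [lintegral_indicator hIm]
      refine hle.trans_lt ?_
      rcases hzS with h | h
      · calc K₂ z ≤ ∫⁻ t in I, (‖D t z‖ₑ ^ p + 1) := lintegral_mono fun t => rpow_sub_one_le hp1 _
          _ = K₁ z + volume I := by
            rw [lintegral_add_right _ measurable_const]; simp [hK₁]
          _ < ∞ := ENNReal.add_lt_top.2 ⟨h1 h, by simp [hI]⟩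
      · exact h2 h
    · simp [HasFiniteIntegral, hF_out _ z hzS]
  have hbd : ∀ h > 0, ∀ᵐ z ∂ν, ∫⁻ t, ‖F t z * steklov h (fun τ => H τ z) t‖ₑ ≤ B z := by
    intro h hh
    refine Eventually.of_forall fun z => ?_
    have hHz := measurable_slice hHm z
    by_cases h1 : z ∈ S₁
    · refine le_trans ?_ (le_self_add : S₁.indicator (fun z => K₁ z + K₃ z) z ≤ _)
      rw [indicator_of_mem h1]
      calc ∫⁻ t, ‖F t z * steklov h (fun τ => H τ z) t‖ₑ
          ≤ ∫⁻ t, (I.indicator (fun t => ‖D t z‖ₑ ^ p) t + ‖steklov h (fun τ => H τ z) t‖ₑ ^ p) := by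
            refine lintegral_mono fun t => ?_
            rw [enorm_mul]
            refine (mul_le_mul_left (hF_le t z) _).trans ?_
            by_cases ht : t ∈ I
            · simp only [indicator_of_mem ht]
              exact rpow_sub_one_mul_le hp1 _ _
            · simp [indicator_of_notMem ht]
        _ = K₁ z + ∫⁻ t, ‖steklov h (fun τ => H τ z) t‖ₑ ^ p := by
            have hm : Measurable fun t => steklov h (fun τ => H τ z) t :=
              (stronglyMeasurable_steklov hHm hh).measurable.comp
                (by fun_prop : Measurable fun t : ℝ => (t, z))
            rw [lintegral_add_right _ (hm.enorm.pow_const p), lintegral_indicator hIm]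
        _ ≤ K₁ z + K₃ z := by
            gcongr
            exact lintegral_steklov_rpow_le (by linarith) hh hHz
    · by_cases h2 : z ∈ S₂
      · refine le_trans ?_ (le_add_self :
          S₂.indicator (fun z => K₂ z * ENNReal.ofReal (M + M)) z ≤ _)
        rw [indicator_of_mem h2]
        calc ∫⁻ t, ‖F t z * steklov h (fun τ => H τ z) t‖ₑ
            ≤ ∫⁻ t, I.indicator (fun t => ‖D t z‖ₑ ^ (p - 1)) t * ENNReal.ofReal (M + M) := by
              refine lintegral_mono fun t => ?_
              rw [enorm_mul]
              refine mul_le_mul' (hF_le t z) ?_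
              rw [← ofReal_norm]
              exact ENNReal.ofReal_le_ofReal (norm_steklov_le hh (fun τ => hHM τ z) t)
          _ = K₂ z * ENNReal.ofReal (M + M) := by
              rw [lintegral_mul_const' _ _ ENNReal.ofReal_ne_top, lintegral_indicator hIm]
      · simp [hF_out _ z (fun h => h.elim h1 h2)]
  obtain ⟨hint, hint0, hlim⟩ := tendsto_integral_mul_steklov (M := M + M) (B := B) hFm hHm hHM
    hslice (hB₁m.add hB₂m) hBfin hbd
  -- Off `S₁ ∪ S₂` both points lie outside `Ω`, so that the cut-off in `F` is harmless.
  have hH_out : ∀ z ∉ S₁ ∪ S₂, z.1 ∉ Ω ∧ z.2 ∉ Ω := fun z hz => by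
    by_contra! hcon
    by_cases h1 : z.1 ∈ Ω
    · by_cases h2 : z.2 ∈ Ω'
      · exact hz (Or.inl ⟨hΩΩ' h1, h2⟩)
      · exact hz (Or.inr (Or.inl ⟨h1, h2⟩))
    · have h2 := hcon h1
      by_cases h3 : z.1 ∈ Ω'
      · exact hz (Or.inl ⟨h3, hΩΩ' h2⟩)
      · exact hz (Or.inr (Or.inr ⟨h3, h2⟩))
  have hprod : (volume.restrict I).prod ν = (volume.prod ν).restrict (I ×ˢ univ) := by
    rw [← Measure.prod_restrict, Measure.restrict_univ]
  have hIum : MeasurableSet (I ×ˢ (univ : Set (Eu n × Eu n))) := hIm.prod MeasurableSet.univ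
  have hFind : ∀ g : ℝ → Eu n × Eu n → ℝ, (∀ t, ∀ z ∉ S₁ ∪ S₂, g t z = 0) →
      (fun q : ℝ × Eu n × Eu n => F q.1 q.2 * g q.1 q.2) =
        (I ×ˢ univ).indicator fun q => J p (D q.1 q.2) * g q.1 q.2 := by
    intro g hg
    funext q
    by_cases hq : q.1 ∈ I
    · rw [indicator_of_mem (show q ∈ I ×ˢ univ from ⟨hq, mem_univ _⟩)]
      by_cases hz : q.2 ∈ S₁ ∪ S₂
      · have e : F q.1 q.2 = J p (D q.1 q.2) :=
          indicator_of_mem (show (q.1, q.2) ∈ I ×ˢ (S₁ ∪ S₂) from ⟨hq, hz⟩) _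
        rw [e]
      · simp [hg _ _ hz]
    · rw [indicator_of_notMem (fun h => hq h.1)]
      have e : F q.1 q.2 = 0 := indicator_of_notMem (fun h => hq h.1) _
      rw [e, zero_mul]
  have hg0 : ∀ t, ∀ z ∉ S₁ ∪ S₂, H t z = 0 := fun t z hz => by
    simp [hH, hψΩ _ _ (hH_out z hz).1, hψΩ _ _ (hH_out z hz).2]
  have hg1 : ∀ h t, ∀ z ∉ S₁ ∪ S₂, steklov h (fun τ => H τ z) t = 0 := fun h t z hz => by
    simp [steklov, hg0 _ z hz]
  rw [hFind H hg0, integrable_indicator_iff hIum] at hint0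
  refine ⟨by rw [hprod]; exact hint0, ?_⟩
  rw [hFind H hg0, integral_indicator hIum] at hlim
  rw [hprod]
  refine Tendsto.congr' ?_ hlim
  filter_upwards [self_mem_nhdsWithin] with h hh
  have hh' := hint h hh
  rw [hFind _ (hg1 h), integrable_indicator_iff hIum, IntegrableOn, ← hprod] at hh'
  rw [hFind _ (hg1 h), integral_indicator hIum, ← hprod, integral_prod _ hh']
  simp only [hH, steklov_difference hψ hM, hD]

/-! ### Convex functionals of curves in `L²` -/

section compLp

variable {X : Type*} [MeasurableSpace X] {μ : Measure X} [IsFiniteMeasure μ] {g G : ℝ → ℝ}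
  {L K : ℝ≥0}

lemma integrable_comp_Lp (hG : LipschitzWith K G) (G0 : G 0 = 0) (f : Lp ℝ 2 μ) :
    Integrable (fun x => G (f x)) μ :=
  ((Lp.memLp (hG.compLp G0 f)).integrable one_le_two).congr (hG.coeFn_compLp G0 f)

lemma continuous_integral_comp_Lp (hG : LipschitzWith K G) (G0 : G 0 = 0) :
    Continuous fun f : Lp ℝ 2 μ => ∫ x, G (f x) ∂μ := by
  have h1 : MemLp (fun _ : X => (1 : ℝ)) 2 μ := memLp_const 1
  have e : (fun f : Lp ℝ 2 μ => ∫ x, G (f x) ∂μ) =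
      fun f => inner ℝ (h1.toLp _) (hG.compLp G0 f) := by
    funext f
    rw [L2.inner_def]
    refine integral_congr_ae ?_
    filter_upwards [hG.coeFn_compLp G0 f, h1.coeFn_toLp] with x hx hx1
    rw [hx, hx1]
    simp
  rw [e]
  exact continuous_const.inner (hG.continuous_compLp G0)

lemma integral_sub_le_inner_compLp (hg : LipschitzWith L g) (g0 : g 0 = 0)
    (hG : LipschitzWith K G) (G0 : G 0 = 0) (hsub : ∀ a b, G b - G a ≤ g b * (b - a))
    (f₀ f₁ : Lp ℝ 2 μ) :
    (∫ x, G (f₁ x) ∂μ) - ∫ x, G (f₀ x) ∂μ ≤ inner ℝ (f₁ - f₀) (hg.compLp g0 f₁) := by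
  rw [← integral_sub (integrable_comp_Lp hG G0 f₁) (integrable_comp_Lp hG G0 f₀), L2.inner_def]
  refine integral_mono_ae ((integrable_comp_Lp hG G0 f₁).sub (integrable_comp_Lp hG G0 f₀))
    (L2.integrable_inner _ _) ?_
  filter_upwards [hg.coeFn_compLp g0 f₁, Lp.coeFn_sub f₁ f₀] with x h1 h2
  rw [h1, h2]
  simpa using hsub (f₀ x) (f₁ x)

end compLp

/-! ### The energy inequality -/

lemma exists_continuous_curve {s p : ℝ} {Ω Ω' : Set (Eu n)} {f : ℝ → (X0 s p Ω Ω' →ₗ[ℝ] ℝ)}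
    {u : ℝ → Eu n → ℝ} (hu : IsWeakSolution s p Ω Ω' (Ioi 0) f u) {a b : ℝ} (ha : 0 < a)
    (hab : a < b) :
    ∃ U : ℝ → Lp ℝ 2 (volume.restrict Ω), Continuous U ∧ IsL2Curve (Icc a b) Ω u U := by
  obtain ⟨-, -, ⟨U, hUc, hU⟩, -⟩ := hu a b hab fun x hx => ha.trans_le hx.1
  refine ⟨IccExtend hab.le ((Icc a b).domRestrict U),
    (continuousOn_iff_continuous_domRestrict.1 hUc).Icc_extend', fun t ht => ?_⟩
  rw [IccExtend_of_mem _ _ ht]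
  exact hU t ht

/-- The weak formulation, with the pairings in `L²(Ω)` written as inner products. -/
lemma IsWeakSolution.inner_identity {s p : ℝ} {Ω Ω' : Set (Eu n)}
    {f : ℝ → (X0 s p Ω Ω' →ₗ[ℝ] ℝ)} {u : ℝ → Eu n → ℝ}
    (hu : IsWeakSolution s p Ω Ω' (Ioi 0) f u) {a b : ℝ} (ha : 0 < a) (hab : a < b)
    {U : ℝ → Lp ℝ 2 (volume.restrict Ω)} (hU : IsL2Curve (Icc a b) Ω u U)
    {φ : ℝ → Eu n → ℝ} {Φ Θ : ℝ → Lp ℝ 2 (volume.restrict Ω)}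
    (hφ : MemBochner p (Icc a b) (X0 s p Ω Ω') (sobolevENorm s p Ω') φ)
    (hΦc : ContDiff ℝ 1 Φ) (hΦ : ∀ t, HasDerivAt Φ (Θ t) t) (hφΦ : IsL2Curve (Icc a b) Ω φ Φ) :
    -(∫ t in a..b, inner ℝ (U t) (Θ t)) + ∫ t in Icc a b, ∫ z : Eu n × Eu n,
        J p (u t z.1 - u t z.2) * (φ t z.1 - φ t z.2) ∂fracMeasure n s p =
      inner ℝ (U a) (Φ a) - inner ℝ (U b) (Φ b) + ∫ t in Icc a b, dualPair (f t) (φ t) := by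
  obtain ⟨-, -, -, h⟩ := hu a b hab fun x hx => ha.trans_le hx.1
  have hinner : ∀ t ∈ Icc a b, ∀ (V : Lp ℝ 2 (volume.restrict Ω)) (v : Eu n → ℝ),
      V =ᵐ[volume.restrict Ω] v → ∫ x in Ω, u t x * v x = inner ℝ (U t) V := by
    intro t ht V v hv
    rw [L2.inner_def]
    refine integral_congr_ae ?_
    filter_upwards [hU t ht, hv] with x h1 h2
    rw [h1, h2]
    simp [mul_comm]
  have h1 := h φ Φ hφ hΦc.contDiffOn hφΦ
  have e1 : ∫ t in Icc a b, ∫ x in Ω, u t x * (derivWithin Φ (Icc a b) t) x =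
      ∫ t in a..b, inner ℝ (U t) (Θ t) := by
    rw [intervalIntegral.integral_of_le hab.le, ← integral_Icc_eq_integral_Ioc]
    refine setIntegral_congr_fun measurableSet_Icc fun t ht => ?_
    rw [(hΦ t).hasDerivWithinAt.derivWithin (uniqueDiffOn_Icc hab t ht)]
    exact hinner t ht _ _ EventuallyEq.rfl
  rw [e1, hinner a (left_mem_Icc.2 hab.le) _ _ (hφΦ a (left_mem_Icc.2 hab.le)),
    hinner b (right_mem_Icc.2 hab.le) _ _ (hφΦ b (right_mem_Icc.2 hab.le))] at h1
  exact h1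

lemma ae_prod_pair {μ : Measure ℝ} [SFinite μ] {ν : Measure (Eu n × Eu n)} [SFinite ν]
    (hν : ν ≪ volume.prod volume) {P : ℝ → Eu n → Prop}
    (h : ∀ᵐ q ∂μ.prod (volume : Measure (Eu n)), P q.1 q.2) :
    ∀ᵐ q ∂μ.prod ν, P q.1 q.2.1 ∧ P q.1 q.2.2 := by
  have hid : Measure.QuasiMeasurePreserving (id : ℝ → ℝ) μ μ := Measure.QuasiMeasurePreserving.id μ
  have hac : μ.prod ν ≪ μ.prod (volume.prod volume) := Measure.AbsolutelyContinuous.rfl.prod hν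
  have h1 := hac.ae_le ((QuasiMeasurePreserving.prodMap hid
    (Measure.quasiMeasurePreserving_fst (μ := (volume : Measure (Eu n)))
      (ν := (volume : Measure (Eu n))))).ae h)
  have h2 := hac.ae_le ((QuasiMeasurePreserving.prodMap hid
    (Measure.quasiMeasurePreserving_snd (μ := (volume : Measure (Eu n)))
      (ν := (volume : Measure (Eu n))))).ae h)
  filter_upwards [h1, h2] with q hq1 hq2
  exact ⟨hq1, hq2⟩

/-- A measurable bounded representative `ψ` of `g(w)`, defined for all times and supported in
`Ω`. -/
lemma exists_truncation {s p : ℝ} (hp : 2 < p) {Ω : Set (Eu n)} (hΩ : IsOpen Ω)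
    {g : ℝ → ℝ} {L : ℝ≥0} (hg : LipschitzWith L g) (g0 : g 0 = 0) {M : ℝ} (hM : ∀ τ, |g τ| ≤ M)
    {a b : ℝ} {w : ℝ → Eu n → ℝ}
    (hw : MemBochner p (Icc a b) (sobolevZero s p Ω) (sobolevENorm s p univ) w) :
    ∃ ψ : ℝ → Eu n → ℝ, Measurable (Function.uncurry ψ) ∧ (∀ t x, |ψ t x| ≤ M) ∧
      (∀ t, ∀ x ∉ Ω, ψ t x = 0) ∧
      (∀ᵐ q ∂(volume.restrict (Icc a b)).prod (volume : Measure (Eu n)),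
        ψ q.1 q.2 = g (w q.1 q.2)) ∧
      ∀ A : Set (Eu n × Eu n),
        ∫⁻ z in A, (∫⁻ t, ‖ψ t z.1 - ψ t z.2‖ₑ ^ p) ∂fracMeasure n s p < ∞ := by
  have hp0 : 0 < p := by linarith
  have hM0 : 0 ≤ M := (abs_nonneg _).trans (hM 0)
  set w' := hw.1.mk _ with hw'
  have hw'm : Measurable w' := hw.1.stronglyMeasurable_mk.measurable
  have hSm : MeasurableSet (Icc a b ×ˢ Ω) := measurableSet_Icc.prod hΩ.measurableSet
  set ψ : ℝ → Eu n → ℝ := fun t x => (Icc a b ×ˢ Ω).indicator (fun q => g (w' q)) (t, x) with hψ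
  have hψm : Measurable (Function.uncurry ψ) := (hg.continuous.measurable.comp hw'm).indicator hSm
  have hψ_in : ∀ t x, t ∈ Icc a b → x ∈ Ω → ψ t x = g (w' (t, x)) := fun t x ht hx =>
    indicator_of_mem (show (t, x) ∈ Icc a b ×ˢ Ω from ⟨ht, hx⟩) _
  have hψ_t : ∀ t x, t ∉ Icc a b → ψ t x = 0 := fun t x ht => indicator_of_notMem (fun h => ht h.1) _
  have hψ_x : ∀ t, ∀ x ∉ Ω, ψ t x = 0 := fun t x hx => indicator_of_notMem (fun h => hx h.2) _
  have hae0 : ∀ᵐ q ∂(volume.restrict (Icc a b)).prod (volume : Measure (Eu n)),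
      ψ q.1 q.2 = g (w' q) := by
    refine (Measure.ae_prod_iff_ae_ae (p := fun q : ℝ × Eu n => ψ q.1 q.2 = g (w' q))
      (measurableSet_eq_fun hψm (hg.continuous.measurable.comp hw'm))).2 ?_
    filter_upwards [Measure.ae_ae_of_ae_prod hw.1.ae_eq_mk, hw.2.1,
      ae_restrict_mem measurableSet_Icc] with t ht1 ht2 ht3
    filter_upwards [ht1, ae_eq_zero_of_mem_sobolevZero hp hΩ ht2] with x hx1 hx2
    by_cases hx : x ∈ Ω
    · exact hψ_in t x ht3 hx
    · rw [hψ_x t x hx]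
      have : w' (t, x) = 0 := hx1.symm.trans (hx2 hx)
      rw [this, g0]
  have hae : ∀ᵐ q ∂(volume.restrict (Icc a b)).prod (volume : Measure (Eu n)),
      ψ q.1 q.2 = g (w q.1 q.2) := by
    filter_upwards [hae0, hw.1.ae_eq_mk] with q h1 h2
    rw [h1, h2]
  refine ⟨ψ, hψm, fun t x => ?_, hψ_x, hae, fun A => ?_⟩
  · by_cases h : (t, x) ∈ Icc a b ×ˢ Ω
    · rw [hψ_in t x h.1 h.2]; exact hM _
    · have : ψ t x = 0 := indicator_of_notMem h _
      rw [this, abs_zero]; exact hM0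
  · have hpair := ae_prod_pair (P := fun t x => ψ t x = g (w t x))
      (fracMeasure_absolutelyContinuous s p) hae
    calc ∫⁻ z in A, (∫⁻ t, ‖ψ t z.1 - ψ t z.2‖ₑ ^ p) ∂fracMeasure n s p
        ≤ ∫⁻ z, (∫⁻ t, ‖ψ t z.1 - ψ t z.2‖ₑ ^ p) ∂fracMeasure n s p := setLIntegral_le_lintegral _ _
      _ = ∫⁻ z, (∫⁻ t in Icc a b, ‖ψ t z.1 - ψ t z.2‖ₑ ^ p) ∂fracMeasure n s p := by
          refine lintegral_congr fun z => (setLIntegral_eq_of_support_subset ?_).symm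
          intro t ht
          by_contra hcon
          simp [hψ_t _ _ hcon, hp0] at ht
      _ = ∫⁻ t in Icc a b, ∫⁻ z, ‖ψ t z.1 - ψ t z.2‖ₑ ^ p ∂fracMeasure n s p :=
          lintegral_lintegral_swap (f := fun (z : Eu n × Eu n) t => ‖ψ t z.1 - ψ t z.2‖ₑ ^ p)
            (((measurable_difference hψm).comp measurable_swap).enorm.pow_const p).aemeasurable
      _ ≤ ∫⁻ t in Icc a b, (L : ℝ≥0∞) ^ p * sobolevENorm s p univ (w t) ^ p := by
          refine lintegral_mono_ae ?_
          filter_upwards [Measure.ae_ae_of_ae_prod hpair] with t ht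
          rw [sobolevENorm_rpow hp0, univ_prod_univ, Measure.restrict_univ, Measure.restrict_univ]
          refine le_trans ?_ (mul_le_mul_right le_add_self _)
          rw [← lintegral_const_mul' _ _ (ENNReal.rpow_ne_top_of_nonneg hp0.le ENNReal.coe_ne_top)]
          refine lintegral_mono_ae ?_
          filter_upwards [ht] with z hz
          rw [hz.1, hz.2, ← ENNReal.mul_rpow_of_nonneg _ _ hp0.le]
          refine ENNReal.rpow_le_rpow ?_ hp0.le
          have := hg.edist_le_mul (w t z.1) (w t z.2)
          rwa [edist_eq_enorm_sub, edist_eq_enorm_sub] at this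
      _ < ∞ := by
          rw [lintegral_const_mul' _ _ (ENNReal.rpow_ne_top_of_nonneg hp0.le ENNReal.coe_ne_top)]
          exact ENNReal.mul_lt_top (ENNReal.rpow_lt_top_of_nonneg hp0.le ENNReal.coe_ne_top)
            hw.2.2.2

/-- The energy inequality obtained by testing the difference of two equations with Steklov averages
of `g(u - v)`, where `g` is the bounded Lipschitz subgradient of the convex function `G`. -/
lemma energy_inequality {s p : ℝ} (hs : 0 < s) (hp : 2 < p) {Ω Ω' : Set (Eu n)}
    (hΩ : IsOpen Ω) (hΩb : Bornology.IsBounded Ω) (hΩ' : IsOpen Ω')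
    (hΩ'b : Bornology.IsBounded Ω') (hsub : closure Ω ⊆ Ω')
    {f : ℝ → (X0 s p Ω Ω' →ₗ[ℝ] ℝ)} {u v : ℝ → Eu n → ℝ}
    (hu : IsWeakSolution s p Ω Ω' (Ioi 0) f u) (hv : IsWeakSolution s p Ω Ω' (Ioi 0) f v)
    (hw : ∀ T₀ T₁ : ℝ, 0 < T₀ → T₀ < T₁ →
      MemBochner p (Icc T₀ T₁) (sobolevZero s p Ω) (sobolevENorm s p univ) (u - v))
    {g G : ℝ → ℝ} {L K : ℝ≥0} {M : ℝ} (hg : LipschitzWith L g) (g0 : g 0 = 0)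
    (hM : ∀ τ, |g τ| ≤ M) (hG : LipschitzWith K G) (G0 : G 0 = 0)
    (hGg : ∀ a b, G b - G a ≤ g b * (b - a)) {a b : ℝ} (ha : 0 < a) (hab : a < b) :
    Integrable (fun q : ℝ × Eu n × Eu n =>
      (J p (u q.1 q.2.1 - u q.1 q.2.2) - J p (v q.1 q.2.1 - v q.1 q.2.2)) *
        (g (u q.1 q.2.1 - v q.1 q.2.1) - g (u q.1 q.2.2 - v q.1 q.2.2)))
      ((volume.restrict (Icc a b)).prod (fracMeasure n s p)) ∧
    ∫ q : ℝ × Eu n × Eu n,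
      (J p (u q.1 q.2.1 - u q.1 q.2.2) - J p (v q.1 q.2.1 - v q.1 q.2.2)) *
        (g (u q.1 q.2.1 - v q.1 q.2.1) - g (u q.1 q.2.2 - v q.1 q.2.2))
      ∂(volume.restrict (Icc a b)).prod (fracMeasure n s p) ≤
    (∫ x in Ω, G (u a x - v a x)) - ∫ x in Ω, G (u b x - v b x) := by
  have hfinΩ : IsFiniteMeasure ((volume : Measure (Eu n)).restrict Ω) :=
    ⟨by simpa using hΩb.measure_lt_top⟩
  -- Forward averages on `[a, b]` look ahead, hence the larger time interval.
  have hab1 : a < b + 1 := by linarith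
  have hsubI : Icc a b ⊆ Icc a (b + 1) := Icc_subset_Icc_right (by linarith)
  obtain ⟨U, hUc, hU⟩ := exists_continuous_curve hu ha hab1
  obtain ⟨V, hVc, hV⟩ := exists_continuous_curve hv ha hab1
  obtain ⟨ψ, hψm, hψM, hψΩ, hψae, hψfin⟩ := exists_truncation hp hΩ hg g0 hM (hw a (b + 1) ha hab1)
  set W : ℝ → Lp ℝ 2 (volume.restrict Ω) := fun t => U t - V t with hW
  have hWc : Continuous W := hUc.sub hVc
  have hWae : ∀ t ∈ Icc a (b + 1), W t =ᵐ[volume.restrict Ω] fun x => u t x - v t x :=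
    fun t ht => by
      filter_upwards [Lp.coeFn_sub (U t) (V t), hU t ht, hV t ht] with x h1 h2 h3
      rw [h1, Pi.sub_apply, h2, h3]
  set Ψ : ℝ → Lp ℝ 2 (volume.restrict Ω) := fun t => hg.compLp g0 (W t) with hΨ
  have hΨc : Continuous Ψ := (hg.continuous_compLp g0).comp hWc
  set Y : ℝ → ℝ := fun t => ∫ x in Ω, G (W t x) with hY
  have hYc : Continuous Y := (continuous_integral_comp_Lp hG G0).comp hWc
  have hYeq : ∀ t ∈ Icc a (b + 1), Y t = ∫ x in Ω, G (u t x - v t x) := fun t ht => by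
    refine integral_congr_ae ?_
    filter_upwards [hWae t ht] with x hx
    rw [hx]
  have hYsub : ∀ t₀ t₁, Y t₁ - Y t₀ ≤ inner ℝ (W t₁ - W t₀) (Ψ t₁) := fun t₀ t₁ =>
    integral_sub_le_inner_compLp hg g0 hG G0 hGg (W t₀) (W t₁)
  have hΨψ : ∀ᵐ τ ∂volume.restrict (Icc a (b + 1)), Ψ τ =ᵐ[volume.restrict Ω] ψ τ := by
    filter_upwards [Measure.ae_ae_of_ae_prod hψae, ae_restrict_mem measurableSet_Icc] with τ h1 hτ
    filter_upwards [hg.coeFn_compLp g0 (W τ), hWae τ hτ, ae_restrict_of_ae h1] with x h2 h3 h4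
    rw [hΨ]
    simp only
    rw [h2, Function.comp, h3, h4]
    rfl
  obtain ⟨huL, huT, -, -⟩ := hu a b hab fun x hx => ha.trans_le hx.1
  obtain ⟨hvL, hvT, -, -⟩ := hv a b hab fun x hx => ha.trans_le hx.1
  obtain ⟨hui, hulim⟩ := tendsto_diffusion_steklov hs hp hΩ hΩb hΩ' hsub huL huT hψm hψM hψΩ
    (hψfin _)
  obtain ⟨hvi, hvlim⟩ := tendsto_diffusion_steklov hs hp hΩ hΩb hΩ' hsub hvL hvT hψm hψM hψΩ
    (hψfin _)
  have hae : ∀ᵐ q : ℝ × Eu n × Eu n ∂(volume.restrict (Icc a b)).prod (fracMeasure n s p),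
      J p (u q.1 q.2.1 - u q.1 q.2.2) * (ψ q.1 q.2.1 - ψ q.1 q.2.2) -
        J p (v q.1 q.2.1 - v q.1 q.2.2) * (ψ q.1 q.2.1 - ψ q.1 q.2.2) =
      (J p (u q.1 q.2.1 - u q.1 q.2.2) - J p (v q.1 q.2.1 - v q.1 q.2.2)) *
        (g (u q.1 q.2.1 - v q.1 q.2.1) - g (u q.1 q.2.2 - v q.1 q.2.2)) := by
    have h1 : ∀ᵐ q ∂(volume.restrict (Icc a b)).prod (volume : Measure (Eu n)),
        ψ q.1 q.2 = g ((u - v) q.1 q.2) :=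
      ae_mono (Measure.prod_mono (Measure.restrict_mono hsubI le_rfl) le_rfl) hψae
    filter_upwards [ae_prod_pair (P := fun t x => ψ t x = g ((u - v) t x))
      (fracMeasure_absolutelyContinuous s p) h1] with q hq
    rw [hq.1, hq.2]
    simp only [Pi.sub_apply]
    ring
  refine ⟨(hui.sub hvi).congr hae, ?_⟩
  rw [← integral_congr_ae hae, integral_sub hui hvi]
  have haI := hsubI (left_mem_Icc.2 hab.le)
  have hbI := hsubI (right_mem_Icc.2 hab.le)
  rw [← hYeq a haI, ← hYeq b hbI]
  set P : ℝ → ℝ := fun t => inner ℝ (W t) (Ψ t) - Y t with hP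
  have hPc : Continuous P := (hWc.inner hΨc).sub hYc
  have hR : Tendsto (fun h => inner ℝ (W a) (steklov h Ψ a) - inner ℝ (W b) (steklov h Ψ b) +
      (steklov h P b - steklov h P a)) (𝓝[>] 0)
      (𝓝 (inner ℝ (W a) (Ψ a) - inner ℝ (W b) (Ψ b) + (P b - P a))) :=
    ((tendsto_const_nhds.inner (tendsto_steklov hΨc a)).sub
      (tendsto_const_nhds.inner (tendsto_steklov hΨc b))).add
      ((tendsto_steklov hPc b).sub (tendsto_steklov hPc a))
  have hRe : inner ℝ (W a) (Ψ a) - inner ℝ (W b) (Ψ b) + (P b - P a) = Y a - Y b := by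
    simp only [hP]; ring
  rw [hRe] at hR
  refine le_of_tendsto_of_tendsto (hulim.sub hvlim) hR ?_
  filter_upwards [Ioc_mem_nhdsGT (zero_lt_one (α := ℝ))] with h hh
  have hφ := memBochner_steklov (Ω' := Ω') (a := a) (b := b) hs hp hΩ'b hψm hψM hψΩ (hψfin _) hh.1
  have hcurve : IsL2Curve (Icc a b) Ω (fun t x => steklov h (fun τ => ψ τ x) t) (steklov h Ψ) :=
    fun t ht => by
      have hIoc : Ioc t (t + h) ⊆ Icc a (b + 1) := fun τ hτ =>
        ⟨ht.1.trans hτ.1.le, hτ.2.trans (add_le_add ht.2 hh.2)⟩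
      exact steklov_ae_eq hψm hψM hΨc hh.1 (ae_mono (Measure.restrict_mono hIoc le_rfl) hΨψ)
  have iu := hu.inner_identity ha hab (fun t ht => hU t (hsubI ht)) hφ (contDiff_steklov hΨc h)
    (hasDerivAt_steklov hΨc h) hcurve
  have iv := hv.inner_identity ha hab (fun t ht => hV t (hsubI ht)) hφ (contDiff_steklov hΨc h)
    (hasDerivAt_steklov hΨc h) hcurve
  have key := integral_inner_deriv_steklov_le hWc hΨc hYc hYsub hab.le hh.1
  have hΘc : Continuous fun t => h⁻¹ • (Ψ (t + h) - Ψ t) := by fun_prop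
  have esplit : ∫ t in a..b, inner ℝ (W t) (h⁻¹ • (Ψ (t + h) - Ψ t)) =
      (∫ t in a..b, inner ℝ (U t) (h⁻¹ • (Ψ (t + h) - Ψ t))) -
        ∫ t in a..b, inner ℝ (V t) (h⁻¹ • (Ψ (t + h) - Ψ t)) := by
    rw [← intervalIntegral.integral_sub ((hUc.inner hΘc).intervalIntegrable _ _)
      ((hVc.inner hΘc).intervalIntegrable _ _)]
    refine intervalIntegral.integral_congr fun t _ => ?_
    simp only [hW, inner_sub_left]
  have ea : inner ℝ (W a) (steklov h Ψ a) =
      inner ℝ (U a) (steklov h Ψ a) - inner ℝ (V a) (steklov h Ψ a) := inner_sub_left _ _ _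
  have eb : inner ℝ (W b) (steklov h Ψ b) =
      inner ℝ (U b) (steklov h Ψ b) - inner ℝ (V b) (steklov h Ψ b) := inner_sub_left _ _ _
  rw [esplit] at key
  rw [ea, eb]
  linarith

/-! ### Coercivity of the diffusion term -/

/-- A bounded set sees a far ball through the kernel with weight bounded below. This serves as
Poincaré's inequality for functions that vanish outside `Ω`. -/
lemma exists_far_ball (hn : 0 < n) {s p : ℝ} (hs : 0 < s) (hp : 2 < p) {Ω : Set (Eu n)}
    (hΩ : IsOpen Ω) (hΩb : Bornology.IsBounded Ω) :
    ∃ (c : ℝ) (B : Set (Eu n)), 0 < c ∧ MeasurableSet B ∧ Disjoint Ω B ∧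
      ∀ φ : Eu n → ℝ≥0∞, AEMeasurable φ volume →
        ENNReal.ofReal c * ∫⁻ x in Ω, φ x ≤ ∫⁻ z in Ω ×ˢ B, φ z.1 ∂fracMeasure n s p := by
  obtain ⟨R, hR⟩ := hΩb.exists_norm_le
  have hα : 0 < (n : ℝ) + s * p := by positivity
  set α := (n : ℝ) + s * p with hαdef
  set R' := max R 0
  have hR'0 : 0 ≤ R' := le_max_right _ _
  have hRx : ∀ x ∈ Ω, ‖x‖ ≤ R' := fun x hx => (hR x hx).trans (le_max_left _ _)
  set e : Eu n := EuclideanSpace.single ⟨0, hn⟩ (R' + 2)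
  have he : ‖e‖ = R' + 2 := by
    simp only [e, PiLp.norm_single, Real.norm_eq_abs]
    exact abs_of_nonneg (by linarith)
  set B := Metric.ball e 1
  set D := 2 * R' + 3
  have hB : ∀ y ∈ B, ‖y - e‖ < 1 := fun y hy => by rwa [← dist_eq_norm]
  have hlow : ∀ x ∈ Ω, ∀ y ∈ B, 1 < ‖x - y‖ := fun x hx y hy => by
    have h1 := hB y hy
    have h2 := hRx x hx
    have h3 : ‖e‖ ≤ ‖y - e‖ + ‖x - y‖ + ‖x‖ := by
      calc ‖e‖ = ‖-(y - e) - (x - y) + x‖ := by congr 1; abel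
        _ ≤ ‖-(y - e)‖ + ‖x - y‖ + ‖x‖ := (norm_add_le _ _).trans (by gcongr; exact norm_sub_le _ _)
        _ = _ := by rw [norm_neg]
    linarith
  have hup : ∀ x ∈ Ω, ∀ y ∈ B, ‖x - y‖ ≤ D := fun x hx y hy => by
    have h1 := hB y hy
    have h2 := hRx x hx
    calc ‖x - y‖ = ‖x - (y - e) - e‖ := by congr 1; abel
      _ ≤ ‖x‖ + ‖y - e‖ + ‖e‖ := (norm_sub_le _ _).trans (by gcongr; exact norm_sub_le _ _)
      _ ≤ D := by simp only [D]; linarith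
  have hvB : 0 < volume B := Metric.measure_ball_pos _ _ one_pos
  have hvB' : volume B < ∞ := measure_ball_lt_top
  have hD : 0 < D := by simp only [D]; linarith
  have hΩm := hΩ.measurableSet
  have hBm : MeasurableSet B := measurableSet_ball
  refine ⟨D ^ (-α) * (volume B).toReal, B, mul_pos (Real.rpow_pos_of_pos hD _)
    (ENNReal.toReal_pos hvB.ne' hvB'.ne), hBm, ?_, fun φ hφ => ?_⟩
  · refine Set.disjoint_left.2 fun x hx hxB => ?_
    have := hlow x hx x hxB
    simp only [sub_self, norm_zero] at this
    linarith
  · have hle : ENNReal.ofReal (D ^ (-α)) • ((volume.restrict Ω).prod (volume.restrict B)) ≤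
        (fracMeasure n s p).restrict (Ω ×ˢ B) := by
      rw [Measure.prod_restrict, fracMeasure, restrict_withDensity (hΩm.prod hBm),
        ← withDensity_const]
      refine withDensity_mono ?_
      rw [EventuallyLE, ae_restrict_iff' (hΩm.prod hBm)]
      refine Eventually.of_forall fun z hz => ENNReal.ofReal_le_ofReal ?_
      exact Real.rpow_le_rpow_of_nonpos (by have := hlow _ hz.1 _ hz.2; linarith)
        (hup _ hz.1 _ hz.2) (by linarith)
    refine le_trans (le_of_eq ?_) (lintegral_mono' hle le_rfl)
    rw [lintegral_smul_measure, lintegral_prod_symm (fun z : Eu n × Eu n => φ z.1)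
      (hφ.restrict.comp_quasiMeasurePreserving Measure.quasiMeasurePreserving_fst)]
    simp only [lintegral_const, Measure.restrict_apply_univ, smul_eq_mul]
    rw [ENNReal.ofReal_mul (Real.rpow_nonneg hD.le _), ENNReal.ofReal_toReal hvB'.ne]
    ring

/-- Lower bound for the diffusion term tested with the truncated power of the difference of two
functions, uniform in the truncation height `k`. -/
lemma exists_coercive (hn : 0 < n) {s p m : ℝ} (hs : 0 < s) (hp : 2 < p) (hm : 2 ≤ m)
    {Ω : Set (Eu n)} (hΩ : IsOpen Ω) (hΩb : Bornology.IsBounded Ω) :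
    ∃ κ : ℝ, 0 < κ ∧ ∀ (k : ℝ) (u v : Eu n → ℝ), 0 < k →
      AEStronglyMeasurable (fun x => u x - v x) volume →
      (∀ᵐ x ∂(volume : Measure (Eu n)), x ∉ Ω → u x - v x = 0) →
      ENNReal.ofReal (κ * (∫ x in Ω, truncPrim m k (u x - v x)) ^ (1 + (p - 2) / m)) ≤
        ∫⁻ z : Eu n × Eu n, ENNReal.ofReal ((J p (u z.1 - u z.2) - J p (v z.1 - v z.2)) *
          (truncPow m k (u z.1 - v z.1) - truncPow m k (u z.2 - v z.2))) ∂fracMeasure n s p := by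
  obtain ⟨c, B, hc, hBm, hdisj, hB⟩ := exists_far_ball hn hs hp hΩ hΩb
  set σ := (p - 2) / m with hσdef
  have hσ : 0 < σ := div_pos (by linarith) (by linarith)
  set A := (volume Ω).toReal + 1 with hA
  have hA0 : 0 < A := by positivity
  have hΩA : volume Ω ≤ ENNReal.ofReal A := by
    rw [← ENNReal.ofReal_toReal hΩb.measure_lt_top.ne]
    exact ENNReal.ofReal_le_ofReal (by linarith)
  refine ⟨c * 2 ^ (1 - p) * A ^ (-σ), by positivity, fun k u v hk hwm hw0 => ?_⟩
  set w : Eu n → ℝ := fun x => u x - v x with hw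
  have hG0 := truncPrim_nonneg hm hk
  have hGm : AEStronglyMeasurable (fun x => truncPrim m k (w x)) volume :=
    (lipschitzWith_truncPrim hm hk).continuous.comp_aestronglyMeasurable hwm
  have hY0 : 0 ≤ ∫ x in Ω, truncPrim m k (w x) := integral_nonneg fun x => hG0 _
  have hYle : ENNReal.ofReal (∫ x in Ω, truncPrim m k (w x)) ≤
      ∫⁻ x in Ω, ENNReal.ofReal (truncPrim m k (w x)) := by
    by_cases hi : Integrable (fun x => truncPrim m k (w x)) (volume.restrict Ω)
    · exact (ofReal_integral_eq_lintegral_ofReal hi (Eventually.of_forall fun x => hG0 _)).le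
    · simp [integral_undef hi]
  have hJensen : ENNReal.ofReal (A ^ (-σ) * (∫ x in Ω, truncPrim m k (w x)) ^ (1 + σ)) ≤
      ∫⁻ x in Ω, ENNReal.ofReal (|w x| ^ (p - 1) * |truncPow m k (w x)|) := by
    calc ENNReal.ofReal (A ^ (-σ) * (∫ x in Ω, truncPrim m k (w x)) ^ (1 + σ))
        = ENNReal.ofReal A ^ (-σ) *
            ENNReal.ofReal (∫ x in Ω, truncPrim m k (w x)) ^ (1 + σ) := by
          rw [ENNReal.ofReal_mul (by positivity), ENNReal.ofReal_rpow_of_pos hA0,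
            ENNReal.ofReal_rpow_of_nonneg hY0 (by linarith)]
      _ ≤ ENNReal.ofReal A ^ (-σ) * (ENNReal.ofReal A ^ σ *
            ∫⁻ x in Ω, ENNReal.ofReal (truncPrim m k (w x)) ^ (1 + σ)) := by
          gcongr
          refine (ENNReal.rpow_le_rpow hYle (by linarith)).trans ?_
          refine (rpow_lintegral_le (by linarith) hGm.restrict.aemeasurable.ennreal_ofReal).trans ?_
          rw [add_sub_cancel_left, Measure.restrict_apply_univ]
          gcongr
      _ = ∫⁻ x in Ω, ENNReal.ofReal (truncPrim m k (w x)) ^ (1 + σ) := by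
          rw [← mul_assoc, ← ENNReal.rpow_add _ _ (by simpa using hA0) ENNReal.ofReal_ne_top,
            neg_add_cancel, ENNReal.rpow_zero, one_mul]
      _ ≤ _ := by
          refine lintegral_mono fun x => ?_
          rw [ENNReal.ofReal_rpow_of_nonneg (hG0 _) (by linarith)]
          exact ENNReal.ofReal_le_ofReal (truncPrim_rpow_le hp hm hk _)
  have hφm : AEMeasurable
      (fun x => ENNReal.ofReal (2 ^ (1 - p) * (|w x| ^ (p - 1) * |truncPow m k (w x)|))) volume := by
    have h1 : Continuous fun τ : ℝ => 2 ^ (1 - p) * (|τ| ^ (p - 1) * |truncPow m k τ|) :=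
      continuous_const.mul ((continuous_abs.rpow_const fun _ => Or.inr (by linarith)).mul
        (continuous_truncPow hm hk).abs)
    exact (h1.comp_aestronglyMeasurable hwm).aemeasurable.ennreal_ofReal
  calc ENNReal.ofReal (c * 2 ^ (1 - p) * A ^ (-σ) *
        (∫ x in Ω, truncPrim m k (w x)) ^ (1 + σ))
      = ENNReal.ofReal c * (ENNReal.ofReal (2 ^ (1 - p)) *
          ENNReal.ofReal (A ^ (-σ) * (∫ x in Ω, truncPrim m k (w x)) ^ (1 + σ))) := by
        rw [← ENNReal.ofReal_mul (by positivity), ← ENNReal.ofReal_mul hc.le]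
        congr 1; ring
    _ ≤ ENNReal.ofReal c * (ENNReal.ofReal (2 ^ (1 - p)) *
          ∫⁻ x in Ω, ENNReal.ofReal (|w x| ^ (p - 1) * |truncPow m k (w x)|)) := by gcongr
    _ = ENNReal.ofReal c * ∫⁻ x in Ω,
          ENNReal.ofReal (2 ^ (1 - p) * (|w x| ^ (p - 1) * |truncPow m k (w x)|)) := by
        rw [← lintegral_const_mul' _ _ ENNReal.ofReal_ne_top]
        congr 2
        funext x
        rw [← ENNReal.ofReal_mul (by positivity)]
    _ ≤ ∫⁻ z in Ω ×ˢ B, ENNReal.ofReal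
          (2 ^ (1 - p) * (|w z.1| ^ (p - 1) * |truncPow m k (w z.1)|)) ∂fracMeasure n s p :=
        hB _ hφm
    _ ≤ ∫⁻ z in Ω ×ˢ B, ENNReal.ofReal ((J p (u z.1 - u z.2) - J p (v z.1 - v z.2)) *
          (truncPow m k (u z.1 - v z.1) - truncPow m k (u z.2 - v z.2))) ∂fracMeasure n s p := by
        refine lintegral_mono_ae ?_
        refine (ae_restrict_iff' (hΩ.measurableSet.prod hBm)).2 ?_
        have h2 : ∀ᵐ z ∂fracMeasure n s p, z.2 ∉ Ω → w z.2 = 0 :=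
          (fracMeasure_absolutelyContinuous s p).ae_le
            ((Measure.quasiMeasurePreserving_snd (μ := (volume : Measure (Eu n)))).ae hw0)
        filter_upwards [h2] with z hz hzS
        exact ENNReal.ofReal_le_ofReal (rpow_mul_le_J_sub_J_mul hp (truncPow_mono hm) truncPow_zero
          (hz (Set.disjoint_right.1 hdisj hzS.2)))
    _ ≤ _ := setLIntegral_le_lintegral _ _

/-! ### Decay of the truncated energies -/

/-- The two bounds for the truncated energy `∫_Ω G_k(u - v)`, uniform in the truncation height. -/
lemma exists_truncated_decay (hn : 0 < n) {s p m : ℝ} (hs : 0 < s) (hp : 2 < p) (hm : 2 ≤ m)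
    {Ω : Set (Eu n)} (hΩ : IsOpen Ω) (hΩb : Bornology.IsBounded Ω) :
    ∃ κ : ℝ, 0 < κ ∧ ∀ Ω' : Set (Eu n), IsOpen Ω' → Bornology.IsBounded Ω' → closure Ω ⊆ Ω' →
      ∀ (f : ℝ → (X0 s p Ω Ω' →ₗ[ℝ] ℝ)) (u v : ℝ → Eu n → ℝ),
        IsWeakSolution s p Ω Ω' (Ioi 0) f u → IsWeakSolution s p Ω Ω' (Ioi 0) f v →
        (∀ T₀ T₁ : ℝ, 0 < T₀ → T₀ < T₁ →
          MemBochner p (Icc T₀ T₁) (sobolevZero s p Ω) (sobolevENorm s p univ) (u - v)) →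
        ∀ k a b : ℝ, 0 < k → 0 < a → a < b →
          (∫ x in Ω, truncPrim m k (u b x - v b x)) ≤ ∫ x in Ω, truncPrim m k (u a x - v a x) ∧
          (∫ x in Ω, truncPrim m k (u b x - v b x)) ≤ (κ * (b - a)) ^ (-m / (p - 2)) := by
  obtain ⟨κ, hκ, hcoer⟩ := exists_coercive hn hs hp hm hΩ hΩb
  set σ := (p - 2) / m with hσdef
  have hσ : 0 < σ := div_pos (by linarith) (by linarith)
  refine ⟨κ * σ, by positivity, fun Ω' hΩ' hΩ'b hsub f u v hu hv hw k a b hk ha hab => ?_⟩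
  have hfinΩ : IsFiniteMeasure ((volume : Measure (Eu n)).restrict Ω) :=
    ⟨by simpa using hΩb.measure_lt_top⟩
  obtain ⟨L, hL⟩ := lipschitzWith_truncPow hm hk
  have hG := lipschitzWith_truncPrim hm hk
  obtain ⟨U, hUc, hU⟩ := exists_continuous_curve hu ha hab
  obtain ⟨V, hVc, hV⟩ := exists_continuous_curve hv ha hab
  set Y : ℝ → ℝ := fun t => ∫ x in Ω, truncPrim m k ((U t - V t : Lp ℝ 2 _) x) with hY
  have hYc : Continuous Y := (continuous_integral_comp_Lp hG truncPrim_zero).comp (hUc.sub hVc)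
  have hYeq : ∀ t ∈ Icc a b, ∫ x in Ω, truncPrim m k (u t x - v t x) = Y t := fun t ht => by
    refine integral_congr_ae ?_
    filter_upwards [Lp.coeFn_sub (U t) (V t), hU t ht, hV t ht] with x h1 h2 h3
    rw [h1, Pi.sub_apply, h2, h3]
  have hY0 : ∀ t, 0 ≤ Y t := fun t => integral_nonneg fun x => truncPrim_nonneg hm hk _
  have hYpow : Continuous fun t => κ * Y t ^ (1 + σ) :=
    (hYc.rpow_const fun _ => Or.inr (by linarith)).const_mul κ
  have step : ∀ t ∈ Icc a b, Y b + κ * ∫ r in t..b, Y r ^ (1 + σ) ≤ Y t := by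
    intro t ht
    rcases ht.2.eq_or_lt with rfl | htb
    · simp
    have ht0 : 0 < t := ha.trans_le ht.1
    obtain ⟨hi, hle⟩ := energy_inequality hs hp hΩ hΩb hΩ' hΩ'b hsub hu hv hw hL truncPow_zero
      (abs_truncPow_le hm hk) hG truncPrim_zero (truncPrim_sub_le hm hk) ht0 htb
    rw [hYeq t ht, hYeq b (right_mem_Icc.2 hab.le)] at hle
    rw [← intervalIntegral.integral_const_mul, intervalIntegral.integral_of_le htb.le,
      ← integral_Icc_eq_integral_Ioc]
    refine le_sub_iff_add_le'.1 (le_trans ?_ hle)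
    have hnn : ∀ q : ℝ × Eu n × Eu n,
        0 ≤ (J p (u q.1 q.2.1 - u q.1 q.2.2) - J p (v q.1 q.2.1 - v q.1 q.2.2)) *
          (truncPow m k (u q.1 q.2.1 - v q.1 q.2.1) - truncPow m k (u q.1 q.2.2 - v q.1 q.2.2)) :=
      fun q => J_sub_J_mul_nonneg hp (truncPow_mono hm) _ _ _ _
    rw [← ENNReal.ofReal_le_ofReal_iff (integral_nonneg hnn),
      ofReal_integral_eq_lintegral_ofReal hYpow.integrableOn_Icc
        (Eventually.of_forall fun r => mul_nonneg hκ.le (Real.rpow_nonneg (hY0 r) _)),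
      ofReal_integral_eq_lintegral_ofReal hi (Eventually.of_forall hnn),
      lintegral_prod _ hi.aestronglyMeasurable.aemeasurable.ennreal_ofReal]
    refine lintegral_mono_ae ?_
    filter_upwards [(hw t b ht0 htb).2.1, ae_restrict_mem measurableSet_Icc] with r hr hrI
    rw [← hYeq r ⟨ht.1.trans hrI.1, hrI.2⟩]
    refine hcoer k (u r) (v r) hk ?_ (ae_eq_zero_of_mem_sobolevZero hp hΩ hr)
    have := hr.1.1.aestronglyMeasurable
    rwa [Measure.restrict_univ] at this
  rw [hYeq a (left_mem_Icc.2 hab.le), hYeq b (right_mem_Icc.2 hab.le)]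
  refine ⟨?_, ?_⟩
  · have h1 := step a (left_mem_Icc.2 hab.le)
    have h2 : 0 ≤ ∫ r in a..b, Y r ^ (1 + σ) :=
      intervalIntegral.integral_nonneg hab.le fun r _ => Real.rpow_nonneg (hY0 r) _
    have := mul_nonneg hκ.le h2
    linarith
  · have h1 := le_rpow_of_integral_inequality hκ hσ hab hYc hY0 step
    rwa [show -1 / σ = -m / (p - 2) by rw [hσdef]; field_simp] at h1

/-! ### Removal of the truncation -/

lemma powerIntegral_le_of_truncated {m : ℝ} (hm : 2 ≤ m) {Ω : Set (Eu n)}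
    (hΩb : Bornology.IsBounded Ω) {w : Eu n → ℝ} (hw : MemLp w 2 (volume.restrict Ω)) {c : ℝ≥0∞}
    (h : ∀ k : ℝ, 0 < k → ENNReal.ofReal (∫ x in Ω, truncPrim m k (w x)) ≤ c) :
    ∫⁻ x in Ω, ‖w x‖ₑ ^ m ≤ c := by
  have hfinΩ : IsFiniteMeasure ((volume : Measure (Eu n)).restrict Ω) :=
    ⟨by simpa using hΩb.measure_lt_top⟩
  have hint : ∀ j : ℕ, Integrable (fun x => truncPrim m ((j : ℝ) + 1) (w x))
      (volume.restrict Ω) := fun j => by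
    have hj : (0 : ℝ) < (j : ℝ) + 1 := by positivity
    refine (integrable_comp_Lp (lipschitzWith_truncPrim hm hj) truncPrim_zero
      (hw.toLp w)).congr ?_
    filter_upwards [hw.coeFn_toLp] with x hx
    rw [hx]
  calc ∫⁻ x in Ω, ‖w x‖ₑ ^ m
      ≤ ∫⁻ x in Ω, liminf
          (fun j : ℕ => ENNReal.ofReal (truncPrim m ((j : ℝ) + 1) (w x))) atTop := by
        refine lintegral_mono fun x => le_of_eq ?_
        obtain ⟨N, hN⟩ := exists_nat_ge |w x|
        have hev : (fun j : ℕ => ENNReal.ofReal (truncPrim m ((j : ℝ) + 1) (w x))) =ᶠ[atTop]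
            fun _ => ‖w x‖ₑ ^ m := by
          filter_upwards [eventually_ge_atTop N] with j hj
          have : (N : ℝ) ≤ j := by exact_mod_cast hj
          rw [truncPrim_eq hm (by positivity) (by linarith), Real.enorm_eq_ofReal_abs,
            ENNReal.ofReal_rpow_of_nonneg (abs_nonneg _) (by linarith)]
        rw [liminf_congr hev, liminf_const]
    _ ≤ liminf (fun j : ℕ =>
          ∫⁻ x in Ω, ENNReal.ofReal (truncPrim m ((j : ℝ) + 1) (w x))) atTop :=
        lintegral_liminf_le' fun j => (hint j).aestronglyMeasurable.aemeasurable.ennreal_ofReal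
    _ ≤ liminf (fun _ : ℕ => c) atTop := by
        refine liminf_le_liminf (Eventually.of_forall fun j => ?_)
        rw [← ofReal_integral_eq_lintegral_ofReal (hint j)
          (Eventually.of_forall fun x => truncPrim_nonneg hm (by positivity) _)]
        exact h _ (by positivity)
    _ = c := liminf_const c

lemma ofReal_integral_truncPrim_le {m k : ℝ} (hm : 2 ≤ m) (hk : 0 < k) (Ω : Set (Eu n))
    (w : Eu n → ℝ) :
    ENNReal.ofReal (∫ x in Ω, truncPrim m k (w x)) ≤ ∫⁻ x in Ω, ‖w x‖ₑ ^ m := by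
  by_cases hi : Integrable (fun x => truncPrim m k (w x)) (volume.restrict Ω)
  · rw [ofReal_integral_eq_lintegral_ofReal hi
      (Eventually.of_forall fun x => truncPrim_nonneg hm hk _)]
    refine lintegral_mono fun x => ?_
    rw [Real.enorm_eq_ofReal_abs, ENNReal.ofReal_rpow_of_nonneg (abs_nonneg _) (by linarith)]
    exact ENNReal.ofReal_le_ofReal (truncPrim_le hm hk _)
  · simp [integral_undef hi]

lemma IsWeakSolution.memLp_two {s p : ℝ} {Ω Ω' : Set (Eu n)} {f : ℝ → (X0 s p Ω Ω' →ₗ[ℝ] ℝ)}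
    {u : ℝ → Eu n → ℝ} (hu : IsWeakSolution s p Ω Ω' (Ioi 0) f u) {t : ℝ} (ht : 0 < t) :
    MemLp (u t) 2 (volume.restrict Ω) := by
  obtain ⟨U, -, hU⟩ := exists_continuous_curve hu ht (lt_add_one t)
  exact (Lp.memLp (U t)).ae_eq (hU t (left_mem_Icc.2 (lt_add_one t).le))

end FracParabolic

open FracParabolic
theorem mainTheorem3 (n : ℕ) (hn : 0 < n) (s p m : ℝ) (hs₀ : 0 < s) (hs₁ : s < 1)
    (hp : 2 < p) (hm : 2 ≤ m) (Ω : Set (EuclideanSpace ℝ (Fin n))) (hΩ : IsOpen Ω)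
    (hΩb : Bornology.IsBounded Ω) :
    ∃ C : ℝ, 0 < C ∧
      ∀ Ω' : Set (EuclideanSpace ℝ (Fin n)), IsOpen Ω' → Bornology.IsBounded Ω' →
        closure Ω ⊆ Ω' →
      ∀ (f : ℝ → (X0 s p Ω Ω' →ₗ[ℝ] ℝ)) (u v : ℝ → EuclideanSpace ℝ (Fin n) → ℝ),
        (∀ T₀ T₁ : ℝ, 0 < T₀ → T₀ < T₁ → MemBochnerDual (p / (p - 1)) (Set.Icc T₀ T₁) f) →
        IsWeakSolution s p Ω Ω' (Set.Ioi 0) f u →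
        IsWeakSolution s p Ω Ω' (Set.Ioi 0) f v →
        (∀ T₀ T₁ : ℝ, 0 < T₀ → T₀ < T₁ →
          MemBochner p (Set.Icc T₀ T₁) (sobolevZero s p Ω) (sobolevENorm s p Set.univ)
            (u - v)) →
        AntitoneOn (powerIntegral Ω m (u - v)) (Set.Ioi 0) ∧
        ∀ t₁ t₂ : ℝ, 0 < t₁ → t₁ ≤ t₂ →
          powerIntegral Ω m (u - v) t₂ ≤
            min (ENNReal.ofReal C * ENNReal.ofReal (t₂ - t₁) ^ (-m / (p - 2)))
              (powerIntegral Ω m (u - v) t₁) := by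
  obtain ⟨κ, hκ, hdecay⟩ := exists_truncated_decay hn hs₀ hp hm hΩ hΩb
  refine ⟨κ ^ (-m / (p - 2)), by positivity, fun Ω' hΩ' hΩ'b hsub f u v _ hu hv hw => ?_⟩
  have hL2 : ∀ t, 0 < t → MemLp (fun x => u t x - v t x) 2 (volume.restrict Ω) := fun t ht =>
    (hu.memLp_two ht).sub (hv.memLp_two ht)
  have hmono : ∀ t₁ t₂ : ℝ, 0 < t₁ → t₁ ≤ t₂ →
      powerIntegral Ω m (u - v) t₂ ≤ powerIntegral Ω m (u - v) t₁ := by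
    intro t₁ t₂ h1 h12
    rcases h12.eq_or_lt with rfl | hlt
    · exact le_rfl
    refine powerIntegral_le_of_truncated hm hΩb (hL2 t₂ (h1.trans hlt)) fun k hk => ?_
    exact (ENNReal.ofReal_le_ofReal
      (hdecay Ω' hΩ' hΩ'b hsub f u v hu hv hw k t₁ t₂ hk h1 hlt).1).trans
      (ofReal_integral_truncPrim_le hm hk Ω _)
  refine ⟨fun t₁ h1 t₂ _ h12 => hmono t₁ t₂ h1 h12, fun t₁ t₂ h1 h12 =>
    le_min ?_ (hmono t₁ t₂ h1 h12)⟩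
  rcases h12.eq_or_lt with rfl | hlt
  · -- The negative power of `0` is `∞`.
    have hneg : -m / (p - 2) < 0 := div_neg_of_neg_of_pos (by linarith) (by linarith)
    have hC : ENNReal.ofReal (κ ^ (-m / (p - 2))) ≠ 0 := by
      simpa using Real.rpow_pos_of_pos hκ _
    rw [sub_self, ENNReal.ofReal_zero, ENNReal.zero_rpow_of_neg hneg, ENNReal.mul_top hC]
    exact le_top
  · refine powerIntegral_le_of_truncated hm hΩb (hL2 t₂ (h1.trans hlt)) fun k hk => ?_
    have hpos : 0 < t₂ - t₁ := sub_pos.2 hlt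
    rw [ENNReal.ofReal_rpow_of_pos hpos, ← ENNReal.ofReal_mul (by positivity),
      ← Real.mul_rpow hκ.le hpos.le]
    exact ENNReal.ofReal_le_ofReal
      (hdecay Ω' hΩ' hΩ'b hsub f u v hu hv hw k t₁ t₂ hk h1 hlt).2
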